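/- Let $F$ be a field of characteristic $0$ and let $A$ be the free associative $F$-algebra without unit on free generators $x,y$. A monic monomial $m$ is said to divide a monic monomial $n$ if $n=m_1mm_2$ for some (possibly empty) monic monomials $m_1,m_2$. Let $I$ be the two-sided ideal of the $F$-algebra $A$ generated by 1. all monomials of degree $8$; 2. all monomials of degree greater than $2$ in $x$; 3. all monic monomials of degree $7$ except $yxy^3xy$ and $y^2xyxy^2$; 4. all monic monomials of degree less than $7$ that divide neither $yxy^3xy$ nor $y^2xyxy^2$; 5. the polynomial $2xy^3xy-5yxyxy^2-2yxy^3x+5y^2xyxy$; 6. the polynomial $2yxy^3xy-5y^2xyxy^2$. Let $B=A/I$, and let $L=[B]$ be the Lie algebra with underlying vector space $B$ and bracket $[u,v]=uv-vu$. Then $L$ is a nilpotent Lie algebra and it is $5$-Engel, that is, $[u,v,v,v,v,v]=0$ for all $u,v\in L$ (left-normed commutator, $v$ taken five times). Moreover, $L$ is a group, denoted $L^*$, under the Baker–Campbell–Hausdorff product $$u*v=\log(e^ue^v)=u+v+\tfrac12[u,v]+\cdots=\sum_{k\ge1}\frac{(-1)^{k-1}}{k}\sum_{\substack{(r_1,s_1),\dots,(r_k,s_k)\in\mathbb{Z}_{\ge0}^2\\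 r_i+s_i>0}}\frac{[u^{r_1}v^{s_1}\cdots u^{r_k}v^{s_k}]}{\left(\sum_{i=1}^k(r_i+s_i)\right)\prod_{i=1}^k r_i!\,s_i!},$$ where $[z_1z_2\cdots z_m]$ denotes the left-normed commutator $[[\dots[z_1,z_2],\dots],z_m]$ (and $[z_1]=z_1$) and only finitely many terms are nonzero because $L$ is nilpotent. The group $L^*$ is not $5$-Engel: it is not true that $(u,v,v,v,v,v)=1$ for all $u,v\in L^*$, where $(u,v)=u^{-1}v^{-1}uv$ and longer commutators are left-normed. -/

import Mathlib

/-! ### The Lie algebra of an associative algebra, without a unit -/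

/-- `[R]`: the additive group of the associative (not necessarily unital) ring `R`,
regarded as a Lie ring with `⁅u, v⁆ = u v - v u`. -/
def CommutatorLie (R : Type*) : Type _ := R

namespace CommutatorLie

/-- The identity map `R → [R]`. -/
def of {R : Type*} (u : R) : CommutatorLie R := u

/-- The identity map `[R] → R`. -/
def val {R : Type*} (u : CommutatorLie R) : R := u

instance instAddCommGroup {R : Type*} [NonUnitalRing R] : AddCommGroup (CommutatorLie R) :=
  inferInstanceAs (AddCommGroup R)

instance instModule {F R : Type*} [Semiring F] [NonUnitalRing R] [Module F R] :
    Module F (CommutatorLie R) :=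
  inferInstanceAs (Module F R)

instance instLieRing {R : Type*} [NonUnitalRing R] : LieRing (CommutatorLie R) where
  bracket u v := of (val u * val v - val v * val u)
  add_lie u v w := by
    change ((val u + val v) * val w - val w * (val u + val v) : R)
      = (val u * val w - val w * val u) + (val v * val w - val w * val v)
    rw [add_mul, mul_add]; abel
  lie_add u v w := by
    change (val u * (val v + val w) - (val v + val w) * val u : R)
      = (val u * val v - val v * val u) + (val u * val w - val w * val u)
    rw [add_mul, mul_add]; abel
  lie_self u := sub_self (val u * val u)
  leibniz_lie u v w := by
    change (val u * (val v * val w - val w * val v) - (val v * val w - val w * val v) * val u : R)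
      = ((val u * val v - val v * val u) * val w - val w * (val u * val v - val v * val u))
        + (val v * (val u * val w - val w * val u) - (val u * val w - val w * val u) * val v)
    simp only [mul_sub, sub_mul, mul_assoc]; abel

instance instLieAlgebra {F R : Type*} [CommRing F] [NonUnitalRing R] [Module F R]
    [IsScalarTower F R R] [SMulCommClass F R R] : LieAlgebra F (CommutatorLie R) where
  lie_smul t u v := by
    change (val u * (t • val v) - (t • val v) * val u : R) = t • (val u * val v - val v * val u)
    rw [mul_smul_comm, smul_mul_assoc, smul_sub]

end CommutatorLie

/-! ### Engel conditions -/

/-- A Lie ring is `n`-Engel if `[u, v, …, v] = 0` (left-normed, `n` times `v`) for all `u, v`. -/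
def IsEngelLie (L : Type*) [LieRing L] (n : ℕ) : Prop :=
  ∀ u v : L, (fun w => ⁅w, v⁆)^[n] u = 0

/-- A group is `n`-Engel if `(u, v, …, v) = 1` (left-normed, `n` times `v`) for all `u, v`,
where `(u, v) = u⁻¹ v⁻¹ u v`. -/
def IsEngelGroup (G : Type*) [Group G] (n : ℕ) : Prop :=
  ∀ u v : G, (fun w => w⁻¹ * v⁻¹ * w * v)^[n] u = 1

/-! ### The Baker–Campbell–Hausdorff product -/

/-- The left-normed commutator `[z₁, z₂, …, zₘ] = [[…[z₁, z₂], …], zₘ]`. -/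
def leftNormed {L : Type*} [LieRing L] : List L → L
  | [] => 0
  | z :: l => l.foldl (fun u v => ⁅u, v⁆) z

/-- For `p = [(r₁, s₁), …, (rₖ, sₖ)]`, the word `x^{r₁} y^{s₁} ⋯ x^{rₖ} y^{sₖ}`
as a list of letters. -/
def bchWord {L : Type*} (x y : L) (p : List (ℕ × ℕ)) : List L :=
  p.flatMap fun q => List.replicate q.1 x ++ List.replicate q.2 y

/-- For `p = [(r₁, s₁), …, (rₖ, sₖ)]`, the coefficient
`(-1)^(k-1) / (k · ∑ (rᵢ + sᵢ) · ∏ rᵢ! sᵢ!)` (the sign is written as `(-1)^(k+1)`). -/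
def bchCoeff (F : Type*) [Field F] (p : List (ℕ × ℕ)) : F :=
  (-1) ^ (p.length + 1) /
    ((p.length * (p.map fun q => q.1 + q.2).sum *
      (p.map fun q => q.1.factorial * q.2.factorial).prod : ℕ) : F)

/-- The Baker–Campbell–Hausdorff product `x * y = log (eˣ eʸ) = x + y + ½[x, y] + ⋯`, in the form
of Dynkin's formula
`∑ₖ (-1)^(k-1)/k ∑ [x^{r₁} y^{s₁} ⋯ x^{rₖ} y^{sₖ}] / (∑ (rᵢ + sᵢ) · ∏ rᵢ! sᵢ!)`,
the inner sum being over all `(r₁, s₁), …, (rₖ, sₖ)` different from `(0, 0)`.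
If `L` is nilpotent, only finitely many terms are nonzero, because there are finitely many
words of each length. -/
noncomputable def bch (F : Type*) {L : Type*} [Field F] [LieRing L] [LieAlgebra F L]
    (x y : L) : L :=
  ∑ᶠ p ∈ {p : List (ℕ × ℕ) | p ≠ [] ∧ (0, 0) ∉ p}, bchCoeff F p • leftNormed (bchWord x y p)

/-! ### Quotients of non-unital algebras -/

/-- The ideal (two-sided, and an `F`-subspace) of the `F`-algebra `R` generated by `S`. -/
def algIdealSpan (F : Type*) {R : Type*} [Field F] [NonUnitalRing R] [Module F R] (S : Set R) :
    Submodule F R :=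
  sInf {J : Submodule F R | S ⊆ J ∧ ∀ a : R, ∀ u ∈ J, a * u ∈ J ∧ u * a ∈ J}

theorem mul_mem_algIdealSpan {F R : Type*} [Field F] [NonUnitalRing R] [Module F R] {S : Set R}
    (a : R) {u : R} (hu : u ∈ algIdealSpan F S) :
    a * u ∈ algIdealSpan F S ∧ u * a ∈ algIdealSpan F S := by
  simp only [algIdealSpan, Submodule.mem_sInf] at hu ⊢
  exact ⟨fun J hJ => (hJ.2 a u (hu J hJ)).1, fun J hJ => (hJ.2 a u (hu J hJ)).2⟩

/-- The quotient of the `F`-algebra `R` by the ideal generated by `S`. -/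
def AlgQuotient (F : Type*) {R : Type*} [Field F] [NonUnitalRing R] [Module F R] (S : Set R) :
    Type _ :=
  R ⧸ algIdealSpan F S

namespace AlgQuotient

instance instAddCommGroup {F R : Type*} [Field F] [NonUnitalRing R] [Module F R] (S : Set R) :
    AddCommGroup (AlgQuotient F S) :=
  inferInstanceAs (AddCommGroup (R ⧸ algIdealSpan F S))

instance instModule {F R : Type*} [Field F] [NonUnitalRing R] [Module F R] (S : Set R) :
    Module F (AlgQuotient F S) :=
  inferInstanceAs (Module F (R ⧸ algIdealSpan F S))

/-- The canonical projection onto the quotient. -/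
def mk {F R : Type*} [Field F] [NonUnitalRing R] [Module F R] (S : Set R) :
    R →ₗ[F] AlgQuotient F S :=
  (algIdealSpan F S).mkQ

theorem mk_surjective {F R : Type*} [Field F] [NonUnitalRing R] [Module F R] (S : Set R) :
    Function.Surjective (mk (F := F) S) :=
  (algIdealSpan F S).mkQ_surjective

theorem mk_eq_mk {F R : Type*} [Field F] [NonUnitalRing R] [Module F R] {S : Set R} {u v : R} :
    mk (F := F) S u = mk S v ↔ u - v ∈ algIdealSpan F S :=
  Submodule.Quotient.eq _

instance instMul {F R : Type*} [Field F] [NonUnitalRing R] [Module F R] (S : Set R) :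
    Mul (AlgQuotient F S) where
  mul := Quotient.map₂ (· * ·) fun u u' hu v v' hv => by
    have hu := (Submodule.quotientRel_def _).1 hu
    have hv := (Submodule.quotientRel_def _).1 hv
    refine (Submodule.quotientRel_def _).2 ?_
    have h : u * v - u' * v' = (u - u') * v + u' * (v - v') := by
      rw [sub_mul, mul_sub]; abel
    rw [h]
    exact add_mem (mul_mem_algIdealSpan v hu).2 (mul_mem_algIdealSpan u' hv).1

theorem mk_mul {F R : Type*} [Field F] [NonUnitalRing R] [Module F R] (S : Set R) (u v : R) :
    mk (F := F) S (u * v) = mk S u * mk S v := rfl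

instance instNonUnitalRing {F R : Type*} [Field F] [NonUnitalRing R] [Module F R] (S : Set R) :
    NonUnitalRing (AlgQuotient F S) where
  left_distrib u v w := by
    obtain ⟨u, rfl⟩ := mk_surjective S u
    obtain ⟨v, rfl⟩ := mk_surjective S v
    obtain ⟨w, rfl⟩ := mk_surjective S w
    simp only [← mk_mul, ← map_add, mul_add]
  right_distrib u v w := by
    obtain ⟨u, rfl⟩ := mk_surjective S u
    obtain ⟨v, rfl⟩ := mk_surjective S v
    obtain ⟨w, rfl⟩ := mk_surjective S w
    simp only [← mk_mul, ← map_add, add_mul]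
  zero_mul u := by
    obtain ⟨u, rfl⟩ := mk_surjective S u
    rw [← map_zero (mk (F := F) S), ← mk_mul, zero_mul]
  mul_zero u := by
    obtain ⟨u, rfl⟩ := mk_surjective S u
    rw [← map_zero (mk (F := F) S), ← mk_mul, mul_zero]
  mul_assoc u v w := by
    obtain ⟨u, rfl⟩ := mk_surjective S u
    obtain ⟨v, rfl⟩ := mk_surjective S v
    obtain ⟨w, rfl⟩ := mk_surjective S w
    simp only [← mk_mul, mul_assoc]

instance instIsScalarTower {F R : Type*} [Field F] [NonUnitalRing R] [Module F R]
    [IsScalarTower F R R] (S : Set R) :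
    IsScalarTower F (AlgQuotient F S) (AlgQuotient F S) where
  smul_assoc t u v := by
    obtain ⟨u, rfl⟩ := mk_surjective S u
    obtain ⟨v, rfl⟩ := mk_surjective S v
    simp only [smul_eq_mul, ← mk_mul, ← map_smul, smul_mul_assoc]

instance instSMulCommClass {F R : Type*} [Field F] [NonUnitalRing R] [Module F R]
    [SMulCommClass F R R] (S : Set R) :
    SMulCommClass F (AlgQuotient F S) (AlgQuotient F S) where
  smul_comm t u v := by
    obtain ⟨u, rfl⟩ := mk_surjective S u
    obtain ⟨v, rfl⟩ := mk_surjective S v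
    simp only [smul_eq_mul, ← mk_mul, ← map_smul, mul_smul_comm]

end AlgQuotient

/-! ### The algebra `B = A / I` -/

/-- The monic monomials in two noncommuting letters (nonempty words);
the letter `x` is `0`, the letter `y` is `1`. -/
abbrev Mon : Type := FreeSemigroup (Fin 2)

namespace Mon

/-- The letter `x`. -/
def X : Mon := FreeSemigroup.of 0

/-- The letter `y`. -/
def Y : Mon := FreeSemigroup.of 1

/-- The word as a list of letters. -/
def letters (m : Mon) : List (Fin 2) := m.head :: m.tail

/-- The degree. -/
def deg (m : Mon) : ℕ := m.letters.length

/-- The degree in `x`. -/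
def degX (m : Mon) : ℕ := m.letters.count 0

/-- `m` divides `n`: `n = m₁ m m₂` for some, possibly empty, words `m₁`, `m₂`. -/
def Divides (m n : Mon) : Prop :=
  ∃ m₁ m₂ : List (Fin 2), n.letters = m₁ ++ m.letters ++ m₂

/-- `y x y³ x y`. -/
def W₁ : Mon := Y * X * Y * Y * Y * X * Y

/-- `y² x y x y²`. -/
def W₂ : Mon := Y * Y * X * Y * X * Y * Y

end Mon

/-- `A`: the free associative `F`-algebra without unit on `x`, `y`, i.e. the semigroup algebra of
the free semigroup. -/
abbrev FreeA (F : Type*) [Field F] : Type _ := MonoidAlgebra F Mon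

namespace FreeA

/-- A monic monomial as an element of `A`. -/
noncomputable def mon (F : Type*) [Field F] (m : Mon) : FreeA F := MonoidAlgebra.single m 1

/-- `2 x y³ x y - 5 y x y x y² - 2 y x y³ x + 5 y² x y x y`. -/
noncomputable def h₁ (F : Type*) [Field F] : FreeA F :=
  let x := mon F Mon.X
  let y := mon F Mon.Y
  (2 : F) • (x * y * y * y * x * y) - (5 : F) • (y * x * y * x * y * y)
    - (2 : F) • (y * x * y * y * y * x) + (5 : F) • (y * y * x * y * x * y)

/-- `2 y x y³ x y - 5 y² x y x y²`. -/
noncomputable def h₂ (F : Type*) [Field F] : FreeA F :=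
  let x := mon F Mon.X
  let y := mon F Mon.Y
  (2 : F) • (y * x * y * y * y * x * y) - (5 : F) • (y * y * x * y * x * y * y)

/-- The generators of the ideal `I`: the monomials of degree `8`; those of degree greater than `2`
in `x`; those of degree `7` except `W₁` and `W₂`; those of degree less than `7` dividing neither
`W₁` nor `W₂`; and the polynomials `h₁`, `h₂`. (It suffices to take monic monomials, since `I` is
a subspace.) -/
def gens (F : Type*) [Field F] : Set (FreeA F) :=
  mon F '' {m | m.deg = 8} ∪
  mon F '' {m | 2 < m.degX} ∪
  mon F '' {m | m.deg = 7 ∧ m ≠ Mon.W₁ ∧ m ≠ Mon.W₂} ∪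
  mon F '' {m | m.deg < 7 ∧ ¬ m.Divides Mon.W₁ ∧ ¬ m.Divides Mon.W₂} ∪
  {h₁ F, h₂ F}

end FreeA

/-- `B = A / I`. -/
abbrev AlgB (F : Type*) [Field F] : Type _ := AlgQuotient F (FreeA.gens F)

/-!
# A nilpotent `5`-Engel Lie algebra whose Baker–Campbell–Hausdorff group is not `5`-Engel

**The group.** In a nilpotent algebra `exp` and `log` are inverse bijections between the algebra and
the elements `1 + w` of its unitization, so `u * v = log (exp u * exp v)` is a group law; the work is
to see that this is the product given by Dynkin's formula (`bch_eq_nilLog`). Let `g = exp x * exp y`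
and `z = log g`, and write `ad z` for `a ↦ a z - z a`. Conjugation by `g` is `exp (ad z)` on the one
hand and `exp (ad y) * exp (ad x)` on the other. If a derivation `D` fixes `x` and `y`, then
`g⁻¹ D g` is `φ(ad z) (D z)` with `φ(t) = (eᵗ - 1) / t` on the one hand, and `exp (ad y) x + y` on the
other. With `ψ(t) = log (1 + t) / t` and `E = exp (ad y) * exp (ad x) - 1` this gives
`ψ(E) (exp (ad y) x + y) = ψ(e^{ad z} - 1) (φ(ad z) (D z)) = D z` (`nilEval_logQuot_eq_map_nilLog`).
Expanding the left side gives the terms of Dynkin's formula, each without the denominator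
`∑ (rᵢ + sᵢ)`, that is, multiplied by its degree. Applied to `u X` and `v X` in the polynomial ring
over the unitization, with `D = X d/dX`, this determines `z`, because `D` is injective on polynomials
without constant term. Neither a free Lie algebra nor the fact that `z` is a Lie element is needed.

**The algebra.** A word vanishes in `B` unless it divides `y x y³ x y` or `y² x y x y²`
(`wordB_eq_zero`); so `B⁸ = 0`, and `[u, v, v, v, v, v]` lives in degrees `6` and `7`. There only six
words survive, subject to the two relations, and the relevant combinations of their coefficients in
`[u, v, v, v, v, v]` vanish identically (`coeffWord_engelWord_six`, `coeffWord_engelWord_seven`). This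
is the Engel identity.

**The commutator.** Modulo terms of degree at least three in `x`, which vanish in `B`, the group
commutators `(x, y, …, y)` have the form `1 + a + b`, with `a`, `b` of degree `1` and `2` in `x`. By
the fifth step `a` has degree at least five in `y` and vanishes. The quadratic part `b` starts from
`-x [x, y] = x y x`, and each further commutation brackets it with `y` up to higher terms
(`map_iterate_commutator`); after five steps `b = [x y x, y, y, y, y] = 6 y² x y x y²`. This is not zero
in `B`: the functional with the values `5` and `2` at `y x y³ x y` and `y² x y x y²`, and `0` at the
other words, vanishes on `I` (`topFunctional_eq_zero_of_mem`).
-/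

/-! ### Power series evaluated at nilpotent elements -/

section NilEval

open Finset

/-- The value `∑ₙ fₙ zⁿ` of a formal power series `f` at a nilpotent element `z` of a not necessarily
commutative algebra. The sum runs over `n` below the nilpotency class, which is `0` for an element
that is not nilpotent, so that the value is then `0`. -/
noncomputable def nilEval {F A : Type*} [Field F] [Ring A] [Algebra F A] (z : A)
    (f : PowerSeries F) : A :=
  ∑ n ∈ range (nilpotencyClass z), PowerSeries.coeff n f • z ^ n

variable {F A : Type*} [Field F] [Ring A] [Algebra F A]

theorem nilEval_eq_sum {z : A} {M : ℕ} (h : z ^ M = 0) (f : PowerSeries F) :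
    nilEval z f = ∑ n ∈ range M, PowerSeries.coeff n f • z ^ n := by
  have hz : IsNilpotent z := ⟨M, h⟩
  refine sum_subset (range_subset_range.2 (csInf_le (OrderBot.bddBelow _) h)) fun n _ hn => ?_
  rw [pow_eq_zero_of_le (by simpa using hn) (pow_nilpotencyClass hz), smul_zero]

theorem nilEval_add {z : A} (f g : PowerSeries F) :
    nilEval z (f + g) = nilEval z f + nilEval z g := by
  simp [nilEval, add_smul, sum_add_distrib]

theorem nilEval_sub {z : A} (f g : PowerSeries F) :
    nilEval z (f - g) = nilEval z f - nilEval z g := by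
  simp [nilEval, sub_smul, sum_sub_distrib]

theorem nilEval_one {z : A} (hz : IsNilpotent z) : nilEval z (1 : PowerSeries F) = 1 := by
  obtain ⟨M, hM⟩ := hz
  rw [nilEval_eq_sum (M := M + 1) (by rw [pow_succ, hM, zero_mul]), sum_range_succ']
  simp [PowerSeries.coeff_one]

theorem nilEval_X {z : A} (hz : IsNilpotent z) : nilEval z (PowerSeries.X : PowerSeries F) = z := by
  obtain ⟨M, hM⟩ := hz
  rw [nilEval_eq_sum (M := M + 2) (by rw [pow_add, hM, zero_mul]), sum_range_succ', sum_range_succ']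
  simp [PowerSeries.coeff_X]

theorem nilEval_zero (f : PowerSeries F) :
    nilEval (0 : A) f = algebraMap F A (PowerSeries.constantCoeff f) := by
  rw [nilEval_eq_sum (M := 1) (by simp)]
  simp [Algebra.algebraMap_eq_smul_one]

/-- Terms of degree `≥ M` on both sides vanish, so a truncated Cauchy product is a product. -/
theorem sum_antidiagonal_eq_mul_sum {M : ℕ} (f h : ℕ → A) (hf : ∀ i, M ≤ i → f i = 0)
    (hh : ∀ j, M ≤ j → h j = 0) :
    ∑ n ∈ range (2 * M), ∑ p ∈ antidiagonal n, f p.1 * h p.2 =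
      (∑ i ∈ range M, f i) * ∑ j ∈ range M, h j := by
  rw [sum_mul_sum, ← sum_product',
    ← sum_fiberwise_of_maps_to (t := range (2 * M)) (g := fun p : ℕ × ℕ => p.1 + p.2)]
  · refine sum_congr rfl fun n _ => (sum_subset ?_ ?_).symm
    · intro p hp
      simpa using (mem_filter.1 hp).2
    · intro p hp hp'
      rw [HasAntidiagonal.mem_antidiagonal] at hp
      simp only [mem_filter, mem_product, mem_range, hp, and_true, not_and_or, not_lt] at hp'
      rcases hp' with h' | h'
      · rw [hf _ h', zero_mul]
      · rw [hh _ h', mul_zero]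
  · intro p hp
    simp only [mem_product, mem_range] at hp ⊢
    lia

theorem nilEval_mul {z : A} (hz : IsNilpotent z) (f g : PowerSeries F) :
    nilEval z (f * g) = nilEval z f * nilEval z g := by
  obtain ⟨M, hM⟩ := hz
  have hv : ∀ (f : PowerSeries F) i, M ≤ i → PowerSeries.coeff i f • z ^ i = 0 := fun f i hi => by
    rw [pow_eq_zero_of_le hi hM, smul_zero]
  rw [nilEval_eq_sum hM f, nilEval_eq_sum hM g, ← sum_antidiagonal_eq_mul_sum _ _ (hv f) (hv g),
    nilEval_eq_sum (M := 2 * M) (pow_eq_zero_of_le (by lia) hM)]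
  refine sum_congr rfl fun n _ => ?_
  rw [PowerSeries.coeff_mul, sum_smul]
  refine sum_congr rfl fun p hp => ?_
  rw [smul_mul_smul_comm, ← pow_add, HasAntidiagonal.mem_antidiagonal.1 hp]

theorem nilEval_pow {z : A} (hz : IsNilpotent z) (f : PowerSeries F) (n : ℕ) :
    nilEval z (f ^ n) = nilEval z f ^ n := by
  induction n with
  | zero => simp [nilEval_one hz]
  | succ n ih => rw [pow_succ, nilEval_mul hz, ih, pow_succ]

theorem nilEval_pow_eq_zero {z : A} {M : ℕ} (hM : z ^ M = 0) {f : PowerSeries F}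
    (hf : PowerSeries.constantCoeff f = 0) : nilEval z f ^ M = 0 := by
  obtain ⟨g, rfl⟩ := PowerSeries.X_dvd_iff.2 hf
  rw [← nilEval_pow ⟨M, hM⟩, mul_pow, nilEval_mul ⟨M, hM⟩, nilEval_pow ⟨M, hM⟩,
    nilEval_X ⟨M, hM⟩, hM, zero_mul]

theorem isNilpotent_nilEval {z : A} (hz : IsNilpotent z) {f : PowerSeries F}
    (hf : PowerSeries.constantCoeff f = 0) : IsNilpotent (nilEval z f) :=
  hz.imp fun _ hM => nilEval_pow_eq_zero hM hf

theorem nilEval_subst {z : A} (hz : IsNilpotent z) (f : PowerSeries F) {g : PowerSeries F}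
    (hg : PowerSeries.constantCoeff g = 0) :
    nilEval z (f.subst g) = nilEval (nilEval z g) f := by
  obtain ⟨M, hM⟩ := hz
  rw [nilEval_eq_sum (nilEval_pow_eq_zero hM hg), nilEval_eq_sum hM]
  simp_rw [← nilEval_pow ⟨M, hM⟩, nilEval_eq_sum hM, smul_sum]
  rw [sum_comm]
  refine sum_congr rfl fun e he => ?_
  rw [PowerSeries.coeff_subst' (PowerSeries.HasSubst.of_constantCoeff_zero' hg),
    finsum_eq_sum_of_support_subset (s := range M), sum_smul]
  · simp [smul_smul]
  · intro d hd
    by_contra hd'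
    refine hd ?_
    simp only [coe_range, Set.mem_Iio, not_lt] at hd'
    have : PowerSeries.X ^ d ∣ g ^ d := pow_dvd_pow_of_dvd (PowerSeries.X_dvd_iff.2 hg) d
    change PowerSeries.coeff d f • PowerSeries.coeff e (g ^ d) = 0
    rw [PowerSeries.X_pow_dvd_iff.1 this e (lt_of_lt_of_le (mem_range.1 he) hd'), smul_zero]

theorem map_nilEval {B : Type*} [Ring B] [Algebra F B] (φ : A →ₐ[F] B) {z : A}
    (hz : IsNilpotent z) (f : PowerSeries F) : φ (nilEval z f) = nilEval (φ z) f := by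
  obtain ⟨M, hM⟩ := hz
  rw [nilEval_eq_sum hM, nilEval_eq_sum (M := M) (by rw [← map_pow, hM, map_zero]), map_sum]
  simp

theorem nilEval_mem {z : A} {P : Submodule F A} (hP : ∀ n, z ^ (n + 1) ∈ P) {f : PowerSeries F}
    (hf : PowerSeries.constantCoeff f = 0) : nilEval z f ∈ P := by
  refine sum_mem fun n _ => ?_
  cases n with
  | zero => simp [hf]
  | succ n => exact P.smul_mem _ (hP n)

end NilEval

/-! ### Exponential and logarithm -/

section ExpLog

open PowerSeries

theorem derivative_log_mul (F : Type*) [Field F] [CharZero F] :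
    d⁄dX F (log F) * (1 + X) = 1 := by
  rw [deriv_log]
  ext n
  rw [mul_add, mul_one, map_add, coeff_one]
  cases n with
  | zero => simp
  | succ n => simp [coeff_succ_mul_X, pow_succ]

/-- Both sides have derivative `1` and no constant term. -/
theorem log_subst_exp_sub_one (F : Type*) [Field F] [CharZero F] :
    (log F).subst (exp F - 1) = (X : PowerSeries F) := by
  have hs : HasSubst (exp F - 1) := HasSubst.exp_sub_one
  refine derivative.ext ?_ ?_
  · have h := congrArg (PowerSeries.subst (exp F - 1)) (derivative_log_mul F)
    rw [← coe_substAlgHom hs, map_mul, map_one, map_add, map_one, substAlgHom_X,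
      add_sub_cancel, coe_substAlgHom hs] at h
    rw [derivative_subst hs, map_sub, derivative_exp, derivative_one, sub_zero, h, derivative_X]
  · rw [constantCoeff_X]
    exact constantCoeff_subst_eq_zero
      (by simp : constantCoeff (exp F - 1) = 0) _ constantCoeff_log

/-- Both sides satisfy `(1 + X) G' = G` and have constant term `1`. -/
theorem exp_subst_log (F : Type*) [Field F] [CharZero F] :
    (exp F).subst (log F) = (1 + X : PowerSeries F) := by
  have hs : HasSubst (log F) := HasSubst.log
  set G := (exp F).subst (log F) with hG
  set J := d⁄dX F (log F) with hJ
  have hJX : J * (1 + X) = 1 := derivative_log_mul F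
  have hG' : d⁄dX F G = G * J := by
    rw [hG, derivative_subst hs, derivative_exp]
  have hJ' : d⁄dX F J = - J * J := by
    have h := congrArg (d⁄dX F) hJX
    rw [Derivation.leibniz, map_add, derivative_one, derivative_X, smul_eq_mul, smul_eq_mul] at h
    linear_combination J * h - (d⁄dX F J) * hJX
  have h0 : constantCoeff G = 1 := by
    have h : G - 1 = (exp F - 1).subst (log F) := by
      rw [hG, ← coe_substAlgHom hs, map_sub, map_one]
    have h' : constantCoeff (G - 1) = 0 := by
      rw [h]
      exact constantCoeff_subst_eq_zero constantCoeff_log _ (by simp)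
    simpa [sub_eq_zero] using h'
  have hJG : J * G = 1 := by
    refine derivative.ext ?_ ?_
    · rw [Derivation.leibniz, hG', hJ', derivative_one, smul_eq_mul, smul_eq_mul]
      ring
    · have : constantCoeff J = 1 := by
        rw [hJ, ← coeff_zero_eq_constantCoeff_apply, coeff_derivative]
        simp
      simp [this, h0]
  linear_combination (1 + X) * hJG - G * hJX

/-- The power series `(eᵗ - 1) / t`. -/
noncomputable def expQuot (F : Type*) [Field F] : PowerSeries F :=
  mk fun n => ((n + 1).factorial : F)⁻¹

/-- The power series `log (1 + t) / t`. -/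
noncomputable def logQuot (F : Type*) [Field F] : PowerSeries F :=
  mk fun n => (-1) ^ n / (n + 1 : F)

theorem X_mul_expQuot (F : Type*) [Field F] [CharZero F] : X * expQuot F = exp F - 1 := by
  ext n
  cases n with
  | zero => simp
  | succ n => simp [expQuot, coeff_succ_X_mul, coeff_one]

theorem X_mul_logQuot (F : Type*) [Field F] [CharZero F] : X * logQuot F = log F := by
  ext n
  cases n with
  | zero => simp
  | succ n => simp [logQuot, coeff_succ_X_mul, pow_succ]

theorem logQuot_subst_mul_expQuot (F : Type*) [Field F] [CharZero F] :
    (logQuot F).subst (exp F - 1) * expQuot F = 1 := by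
  have hs : HasSubst (exp F - 1) := HasSubst.exp_sub_one
  have h := log_subst_exp_sub_one F
  rw [← X_mul_logQuot, subst_mul hs, ← coe_substAlgHom hs, substAlgHom_X, coe_substAlgHom hs,
    ← X_mul_expQuot, X_mul_expQuot] at h
  refine mul_left_cancel₀ (X_ne_zero (R := F)) ?_
  rw [mul_one]
  conv_rhs => rw [← h]
  rw [← X_mul_expQuot F]
  ring

variable (F : Type*) {A : Type*} [Field F] [CharZero F] [Ring A] [Algebra F A]

/-- The exponential of a nilpotent element. -/
noncomputable def nilExp (z : A) : A := nilEval z (exp F)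

/-- The logarithm of a unipotent element. -/
noncomputable def nilLog (g : A) : A := nilEval (g - 1) (log F)

variable {F}

theorem nilExp_sub_one {z : A} (hz : IsNilpotent z) : nilExp F z - 1 = nilEval z (exp F - 1) := by
  rw [nilEval_sub, nilEval_one hz, nilExp]

theorem isNilpotent_nilExp_sub_one {z : A} (hz : IsNilpotent z) : IsNilpotent (nilExp F z - 1) := by
  rw [nilExp_sub_one hz]
  exact isNilpotent_nilEval hz (by simp)

theorem isNilpotent_nilLog {g : A} (hg : IsNilpotent (g - 1)) : IsNilpotent (nilLog F g) :=
  isNilpotent_nilEval hg constantCoeff_log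

theorem nilLog_nilExp {z : A} (hz : IsNilpotent z) : nilLog F (nilExp F z) = z := by
  rw [nilLog, nilExp_sub_one hz, ← nilEval_subst hz _ (by simp), log_subst_exp_sub_one,
    nilEval_X hz]

theorem nilExp_nilLog {g : A} (hg : IsNilpotent (g - 1)) : nilExp F (nilLog F g) = g := by
  rw [nilLog, nilExp, ← nilEval_subst hg _ constantCoeff_log, exp_subst_log, nilEval_add,
    nilEval_one hg, nilEval_X hg, add_sub_cancel]

/-- With `φ(t) = (eᵗ - 1) / t` and `ψ(t) = log (1 + t) / t`, this is `ψ(eᶻ - 1) φ(z) = 1`. -/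
theorem logQuot_mul_expQuot {z : A} (hz : IsNilpotent z) :
    nilEval (nilExp F z - 1) (logQuot F) * nilEval z (expQuot F) = 1 := by
  rw [nilExp_sub_one hz, ← nilEval_subst hz _ (by simp), ← nilEval_mul hz,
    logQuot_subst_mul_expQuot, nilEval_one hz]

theorem nilExp_eq_sum {z : A} {M : ℕ} (h : z ^ M = 0) :
    nilExp F z = ∑ n ∈ Finset.range M, (n.factorial : F)⁻¹ • z ^ n := by
  rw [nilExp, nilEval_eq_sum h]
  simp

theorem nilExp_zero : nilExp F (0 : A) = 1 := by
  simp [nilExp, nilEval_zero]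

theorem map_nilExp {B : Type*} [Ring B] [Algebra F B] (φ : A →ₐ[F] B) {z : A}
    (hz : IsNilpotent z) : φ (nilExp F z) = nilExp F (φ z) :=
  map_nilEval φ hz _

theorem map_nilLog {B : Type*} [Ring B] [Algebra F B] (φ : A →ₐ[F] B) {g : A}
    (hg : IsNilpotent (g - 1)) : φ (nilLog F g) = nilLog F (φ g) := by
  rw [nilLog, map_nilEval φ hg, map_sub, map_one, nilLog]

end ExpLog

/-! ### Conjugation by exponentials -/

section RightAd

open Finset

/-- Bracketing with `z` on the right, `a ↦ a z - z a`. -/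
def rightAd (F : Type*) {A : Type*} [Field F] [Ring A] [Algebra F A] (z : A) : Module.End F A :=
  LinearMap.mulRight F z - LinearMap.mulLeft F z

variable {F A : Type*} [Field F] [Ring A] [Algebra F A]

theorem rightAd_apply (z a : A) : rightAd F z a = a * z - z * a := rfl

theorem commute_mulLeft_rightAd (z : A) : Commute (LinearMap.mulLeft F z) (rightAd F z) :=
  Commute.sub_right (LinearMap.commute_mulLeft_right z z) (Commute.refl _)

theorem isNilpotent_rightAd {z : A} (hz : IsNilpotent z) : IsNilpotent (rightAd F z) := by
  refine Commute.isNilpotent_sub (LinearMap.commute_mulLeft_right z z).symm ?_ ?_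
  · exact (LinearMap.isNilpotent_mulRight_iff F z).2 hz
  · exact (LinearMap.isNilpotent_mulLeft_iff F z).2 hz

theorem mul_pow_eq_sum_rightAd (a z : A) (n : ℕ) :
    a * z ^ n = ∑ p ∈ antidiagonal n, n.choose p.1 • (z ^ p.1 * (rightAd F z ^ p.2) a) := by
  have h := congrArg (fun T : Module.End F A => T a)
    ((commute_mulLeft_rightAd (F := F) z).add_pow' n)
  simp only [LinearMap.sum_apply, LinearMap.smul_apply, Module.End.mul_apply,
    LinearMap.pow_mulLeft, LinearMap.mulLeft_apply] at h
  rw [← h, rightAd, add_sub_cancel, LinearMap.pow_mulRight, LinearMap.mulRight_apply]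

theorem map_pow_succ_eq_sum_rightAd (D : A →ₗ[F] A) (hD : ∀ a b, D (a * b) = D a * b + a * D b)
    (z : A) (n : ℕ) :
    D (z ^ (n + 1)) =
      ∑ p ∈ antidiagonal n, (n + 1).choose p.1 • (z ^ p.1 * (rightAd F z ^ p.2) (D z)) := by
  induction n with
  | zero => simp
  | succ n ih =>
    rw [pow_succ', hD, ih, mul_pow_eq_sum_rightAd (F := F), Nat.sum_antidiagonal_succ,
      Nat.sum_antidiagonal_succ, mul_sum, add_assoc, ← sum_add_distrib]
    congr 1
    refine sum_congr rfl fun p _ => ?_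
    rw [Nat.choose_succ_succ' (n + 1), add_smul, mul_smul_comm, ← mul_assoc, ← pow_succ', add_comm]

variable [CharZero F]

theorem inv_factorial_mul_choose {n : ℕ} {p : ℕ × ℕ} (hp : p ∈ antidiagonal n) :
    (n.factorial : F)⁻¹ * (n.choose p.1 : F) = (p.1.factorial : F)⁻¹ * (p.2.factorial : F)⁻¹ := by
  have hp := HasAntidiagonal.mem_antidiagonal.1 hp
  have h : n.choose p.1 * p.1.factorial * p.2.factorial = n.factorial := by
    simpa [← hp] using Nat.choose_mul_factorial_mul_factorial (Nat.le_add_right p.1 p.2)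
  have hn : (n.factorial : F) ≠ 0 := Nat.cast_ne_zero.2 n.factorial_ne_zero
  have h1 : (p.1.factorial : F) ≠ 0 := Nat.cast_ne_zero.2 p.1.factorial_ne_zero
  have h2 : (p.2.factorial : F) ≠ 0 := Nat.cast_ne_zero.2 p.2.factorial_ne_zero
  field_simp
  exact_mod_cast h

/-- Conjugation by `exp z` is the exponential of bracketing with `z`. -/
theorem mul_nilExp {z : A} (hz : IsNilpotent z) (a : A) :
    a * nilExp F z = nilExp F z * nilExp F (rightAd F z) a := by
  obtain ⟨M₁, h₁⟩ := hz
  obtain ⟨M₂, h₂⟩ := isNilpotent_rightAd (F := F) ⟨M₁, h₁⟩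
  have h1 : z ^ max M₁ M₂ = 0 := pow_eq_zero_of_le (le_max_left _ _) h₁
  have h2 : rightAd F z ^ max M₁ M₂ = 0 := pow_eq_zero_of_le (le_max_right _ _) h₂
  generalize max M₁ M₂ = M at h1 h2
  rw [nilExp_eq_sum h2, LinearMap.sum_apply, nilExp_eq_sum (z := z) h1, ← sum_antidiagonal_eq_mul_sum,
    ← nilExp_eq_sum h1, nilExp_eq_sum (z := z) (M := 2 * M) (pow_eq_zero_of_le (by lia) h1), mul_sum]
  · refine sum_congr rfl fun n _ => ?_
    rw [mul_smul_comm, mul_pow_eq_sum_rightAd (F := F), smul_sum]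
    refine sum_congr rfl fun p hp => ?_
    rw [LinearMap.smul_apply, smul_mul_smul_comm, ← inv_factorial_mul_choose hp, mul_smul,
      Nat.cast_smul_eq_nsmul]
  · intro i hi
    rw [pow_eq_zero_of_le hi h1, smul_zero]
  · intro i hi
    rw [pow_eq_zero_of_le hi h2, smul_zero, LinearMap.zero_apply]

/-- The derivative of the exponential map. -/
theorem map_nilExp_of_derivation (D : A →ₗ[F] A) (hD : ∀ a b, D (a * b) = D a * b + a * D b)
    {z : A} (hz : IsNilpotent z) :
    D (nilExp F z) = nilExp F z * nilEval (rightAd F z) (expQuot F) (D z) := by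
  obtain ⟨M₁, h₁⟩ := hz
  obtain ⟨M₂, h₂⟩ := isNilpotent_rightAd (F := F) ⟨M₁, h₁⟩
  have h1 : z ^ max M₁ M₂ = 0 := pow_eq_zero_of_le (le_max_left _ _) h₁
  have h2 : rightAd F z ^ max M₁ M₂ = 0 := pow_eq_zero_of_le (le_max_right _ _) h₂
  generalize max M₁ M₂ = M at h1 h2
  have hD1 : D 1 = 0 := by simpa using hD 1 1
  rw [nilEval_eq_sum h2, LinearMap.sum_apply, nilExp_eq_sum (z := z) h1, ← sum_antidiagonal_eq_mul_sum,
    ← nilExp_eq_sum h1, nilExp_eq_sum (z := z) (M := 2 * M + 1) (pow_eq_zero_of_le (by lia) h1),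
    map_sum, sum_range_succ', pow_zero, map_smul, hD1, smul_zero, add_zero]
  · refine sum_congr rfl fun n _ => ?_
    rw [map_smul, map_pow_succ_eq_sum_rightAd D hD, smul_sum]
    refine sum_congr rfl fun p hp => ?_
    have hp' : (p.1, p.2 + 1) ∈ antidiagonal (n + 1) := by
      rw [HasAntidiagonal.mem_antidiagonal] at hp ⊢
      rw [← hp, add_assoc]
    rw [LinearMap.smul_apply, expQuot, PowerSeries.coeff_mk, smul_mul_smul_comm,
      ← inv_factorial_mul_choose hp', mul_smul, Nat.cast_smul_eq_nsmul]
  · intro i hi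
    rw [pow_eq_zero_of_le hi h1, smul_zero]
  · intro i hi
    rw [pow_eq_zero_of_le hi h2, smul_zero, LinearMap.zero_apply]

theorem isUnit_nilExp {z : A} (hz : IsNilpotent z) : IsUnit (nilExp F z) := by
  simpa using (isNilpotent_nilExp_sub_one (F := F) hz).isUnit_add_one

theorem nilExp_neg_mul_nilExp {z : A} (hz : IsNilpotent z) :
    nilExp F (-z) * nilExp F z = 1 := by
  have h : nilExp F (-z) = nilEval z (PowerSeries.evalNegHom (PowerSeries.exp F)) := by
    obtain ⟨M, hM⟩ := hz
    rw [nilExp_eq_sum (M := M) (by rw [neg_pow, hM, mul_zero]), nilEval_eq_sum hM]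
    refine sum_congr rfl fun n _ => ?_
    rcases n.even_or_odd with hn | hn <;>
      simp [PowerSeries.evalNegHom, PowerSeries.coeff_rescale, hn.neg_pow]
  rw [h, nilExp, ← nilEval_mul hz, mul_comm, PowerSeries.exp_mul_exp_neg_eq_one, nilEval_one hz]

/-- Dynkin's identity in operator form. With `exp z = exp x * exp y` and a derivation `D` that fixes
`x` and `y`, both sides are `ψ(e^T - 1) (φ(T) (D z))`, where `T` is bracketing with `z` on the
right, `φ(t) = (eᵗ - 1) / t` and `ψ(t) = log (1 + t) / t`. -/
theorem nilEval_logQuot_eq_map_nilLog (D : A →ₗ[F] A)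
    (hD : ∀ a b, D (a * b) = D a * b + a * D b) {x y : A} (hx : IsNilpotent x) (hy : IsNilpotent y)
    (hg : IsNilpotent (nilExp F x * nilExp F y - 1)) (hDx : D x = x) (hDy : D y = y) :
    IsNilpotent (nilExp F (rightAd F y) * nilExp F (rightAd F x) - 1) ∧
    nilEval (nilExp F (rightAd F y) * nilExp F (rightAd F x) - 1) (logQuot F)
      (nilExp F (rightAd F y) x + y) = D (nilLog F (nilExp F x * nilExp F y)) := by
  set g := nilExp F x * nilExp F y with hgdef
  set z := nilLog F g with hz
  have hzn : IsNilpotent z := isNilpotent_nilLog hg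
  have hzg : nilExp F z = g := nilExp_nilLog hg
  have hgu : IsUnit g := (isUnit_nilExp hx).mul (isUnit_nilExp hy)
  -- Both operators are conjugation by `g`.
  have hE : nilExp F (rightAd F y) * nilExp F (rightAd F x) = nilExp F (rightAd F z) := by
    ext a
    refine hgu.mul_left_cancel ?_
    conv_rhs => rw [← hzg, ← mul_nilExp hzn, hzg, hgdef, ← mul_assoc, mul_nilExp hx, mul_assoc,
      mul_nilExp hy, ← mul_assoc]
    rfl
  have hfix : ∀ {w : A}, IsNilpotent w → D w = w → D (nilExp F w) = nilExp F w * w := by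
    intro w hw hDw
    obtain ⟨M, hM⟩ := isNilpotent_rightAd (F := F) hw
    have h0 : rightAd F w w = 0 := by rw [rightAd_apply, sub_self]
    rw [map_nilExp_of_derivation D hD hw, hDw, nilEval_eq_sum (M := M + 1)
      (by rw [pow_succ, hM, zero_mul]), sum_range_succ']
    simp [pow_succ, h0, expQuot]
  have ha : nilExp F (rightAd F y) x + y = nilEval (rightAd F z) (expQuot F) (D z) := by
    refine hgu.mul_left_cancel ?_
    conv_rhs => rw [← hzg, ← map_nilExp_of_derivation D hD hzn, hzg, hgdef, hD, hfix hx hDx,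
      hfix hy hDy]
    rw [mul_add, hgdef, mul_assoc (nilExp F x), ← mul_nilExp hy]
    simp only [mul_assoc]
  rw [hE]
  refine ⟨isNilpotent_nilExp_sub_one (isNilpotent_rightAd hzn), ?_⟩
  rw [ha, ← Module.End.mul_apply, logQuot_mul_expQuot (isNilpotent_rightAd hzn), Module.End.one_apply]

end RightAd

/-! ### Dynkin's formula -/

section Dynkin

open Finset

attribute [local instance] LieRing.ofAssociativeRing LieAlgebra.ofAssociativeAlgebra

/-- The lists of length `k` with entries in the finite set `S`. -/
def listsOfLength {α : Type*} [DecidableEq α] (S : Finset α) : ℕ → Finset (List α)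
  | 0 => {[]}
  | k + 1 => (listsOfLength S k ×ˢ S).image fun p => p.1 ++ [p.2]

theorem mem_listsOfLength {α : Type*} [DecidableEq α] {S : Finset α} {k : ℕ} {l : List α} :
    l ∈ listsOfLength S k ↔ l.length = k ∧ ∀ q ∈ l, q ∈ S := by
  induction k generalizing l with
  | zero => simp +contextual [listsOfLength, List.length_eq_zero_iff]
  | succ k ih =>
    simp only [listsOfLength, mem_image, mem_product, Prod.exists, ih]
    constructor
    · rintro ⟨p, q, ⟨⟨rfl, hp⟩, hq⟩, rfl⟩
      simpa [or_imp, forall_and] using ⟨hp, hq⟩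
    · rintro ⟨hl, hS⟩
      have hne : l ≠ [] := by rintro rfl; simp at hl
      refine ⟨l.dropLast, l.getLast hne, ⟨⟨by simp [hl], fun q hq => ?_⟩, ?_⟩, ?_⟩
      · exact hS q (List.mem_of_mem_dropLast hq)
      · exact hS _ (List.getLast_mem hne)
      · exact List.dropLast_append_getLast hne

theorem sum_listsOfLength_succ {α A : Type*} [DecidableEq α] [AddCommMonoid A] (S : Finset α)
    (k : ℕ) (f : List α → A) :
    ∑ l ∈ listsOfLength S (k + 1), f l = ∑ l ∈ listsOfLength S k, ∑ q ∈ S, f (l ++ [q]) := by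
  rw [listsOfLength, sum_image, sum_product]
  rintro ⟨l, q⟩ _ ⟨l', q'⟩ _ h
  have h := List.append_inj' h rfl
  simp only [List.cons.injEq, and_true] at h
  rw [h.1, h.2]

theorem leftNormed_append {L : Type*} [LieRing L] {l : List L} (hl : l ≠ []) (l' : List L) :
    leftNormed (l ++ l') = l'.foldl (fun u v => ⁅u, v⁆) (leftNormed l) := by
  cases l with
  | nil => exact (hl rfl).elim
  | cons z l => simp [leftNormed]

theorem foldl_lie_replicate {F A : Type*} [Field F] [Ring A] [Algebra F A] (n : ℕ) (z a : A) :
    (List.replicate n z).foldl (fun u v => ⁅u, v⁆) a = (rightAd F z ^ n) a := by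
  induction n generalizing a with
  | zero => simp
  | succ n ih => rw [List.replicate_succ, List.foldl_cons, ih, pow_succ]; rfl

theorem map_leftNormed {L L' : Type*} [LieRing L] [LieRing L'] (φ : L →+ L')
    (hφ : ∀ u v, φ ⁅u, v⁆ = ⁅φ u, φ v⁆) (l : List L) :
    φ (leftNormed l) = leftNormed (l.map φ) := by
  cases l with
  | nil => exact map_zero φ
  | cons z l =>
    simp only [leftNormed, List.map_cons]
    induction l generalizing z with
    | nil => rfl
    | cons w l ih => simp only [List.foldl_cons, List.map_cons, ih, hφ]

theorem map_bchWord {L L' : Type*} (f : L → L') (x y : L) (p : List (ℕ × ℕ)) :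
    (bchWord x y p).map f = bchWord (f x) (f y) p := by
  simp [bchWord, List.map_flatMap]

theorem bchWord_append {L : Type*} (x y : L) (p p' : List (ℕ × ℕ)) :
    bchWord x y (p ++ p') = bchWord x y p ++ bchWord x y p' := by
  simp [bchWord]

theorem length_bchWord {L : Type*} (x y : L) (p : List (ℕ × ℕ)) :
    (bchWord x y p).length = (p.map fun q => q.1 + q.2).sum := by
  simp [bchWord, List.length_flatMap]

theorem mem_bchWord {L : Type*} {x y z : L} {p : List (ℕ × ℕ)} (h : z ∈ bchWord x y p) :
    z = x ∨ z = y := by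
  simp only [bchWord, List.mem_flatMap, List.mem_append, List.mem_replicate] at h
  grind

theorem length_le_length_bchWord {L : Type*} (x y : L) {p : List (ℕ × ℕ)} (hp : (0, 0) ∉ p) :
    p.length ≤ (bchWord x y p).length := by
  rw [length_bchWord]
  induction p with
  | nil => simp
  | cons q p ih =>
    simp only [List.mem_cons, not_or] at hp
    have : q.1 + q.2 ≠ 0 := fun h => hp.1 (Prod.ext (by grind) (by grind))
    simp only [List.length_cons, List.map_cons, List.sum_cons]
    have := ih hp.2
    lia

theorem bchWord_ne_nil {L : Type*} (x y : L) {p : List (ℕ × ℕ)} (hp : (0, 0) ∉ p) (h : p ≠ []) :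
    bchWord x y p ≠ [] := by
  have h1 := length_le_length_bchWord x y hp
  have h2 := List.length_pos_iff.2 h
  exact List.length_pos_iff.1 (by lia)

/-- A derivation multiplies a left-normed commutator of elements that it fixes by the length. -/
theorem map_leftNormed_of_derivation {A : Type*} [Ring A] (D : A →+ A)
    (hD : ∀ a b, D (a * b) = D a * b + a * D b) {l : List A} (hl : ∀ a ∈ l, D a = a) :
    D (leftNormed l) = l.length • leftNormed l := by
  have hlie : ∀ a b, D ⁅a, b⁆ = ⁅D a, b⁆ + ⁅a, D b⁆ := fun a b => by
    simp only [Ring.lie_def, map_sub, hD]; abel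
  induction l using List.reverseRecOn with
  | nil => simp [leftNormed]
  | append_singleton l a ih =>
    rcases eq_or_ne l [] with rfl | hne
    · simpa [leftNormed] using hl a (by simp)
    · rw [leftNormed_append hne, List.foldl_cons, List.foldl_nil, hlie, hl a (by simp),
        ih fun b hb => hl b (by simp [hb]), nsmul_lie, List.length_append, List.length_singleton,
        add_smul, one_smul]

/-- The pairs of exponents below `M`, not both zero. -/
def exponentBox (M : ℕ) : Finset (ℕ × ℕ) := (range M ×ˢ range M).erase (0, 0)

/-- The factor `∏ 1 / (rᵢ! sᵢ!)` of the coefficients of Dynkin's formula. -/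
def factorialCoeff (F : Type*) [Field F] (p : List (ℕ × ℕ)) : F :=
  (p.map fun q => (q.1.factorial : F)⁻¹ * (q.2.factorial : F)⁻¹).prod

variable {F A : Type*} [Field F] [CharZero F] [Ring A] [Algebra F A]

theorem prod_map_factorial_ne_zero (p : List (ℕ × ℕ)) :
    (p.map fun q => q.1.factorial * q.2.factorial).prod ≠ 0 := by
  simp [List.prod_eq_zero_iff, Nat.factorial_ne_zero]

theorem bchCoeff_mul_length {L : Type*} (x y : L) {p : List (ℕ × ℕ)} (hp : (0, 0) ∉ p)
    (hne : p ≠ []) :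
    bchCoeff F p * ((bchWord x y p).length : F) =
      (-1) ^ (p.length + 1) / (p.length : F) * factorialCoeff F p := by
  have h0 : ((bchWord x y p).length : F) ≠ 0 := by
    simpa using bchWord_ne_nil x y hp hne
  have h1 : (p.length : F) ≠ 0 := by simpa using hne
  have h2 : factorialCoeff F p =
      (((p.map fun q => q.1.factorial * q.2.factorial).prod : ℕ) : F)⁻¹ := by
    clear h0 h1 hp hne
    induction p with
    | nil => simp [factorialCoeff]
    | cons q p ih =>
      simp only [factorialCoeff, List.map_cons, List.prod_cons] at ih ⊢
      rw [ih]
      push_cast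
      rw [mul_inv, mul_inv]
  have h3 : (((p.map fun q => q.1.factorial * q.2.factorial).prod : ℕ) : F) ≠ 0 :=
    Nat.cast_ne_zero.2 (prod_map_factorial_ne_zero p)
  rw [bchCoeff, h2, ← length_bchWord x y]
  push_cast at h3 ⊢
  field_simp

/-- `exp y * exp x - 1`, acting by right bracketing, as a sum over the exponents. -/
theorem nilExp_rightAd_mul_sub_one_eq_sum {x y : A} {M : ℕ} (hM : 0 < M)
    (hx : rightAd F x ^ M = 0) (hy : rightAd F y ^ M = 0) :
    nilExp F (rightAd F y) * nilExp F (rightAd F x) - 1 =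
      ∑ q ∈ exponentBox M, ((q.1.factorial : F)⁻¹ * (q.2.factorial : F)⁻¹) •
        (rightAd F y ^ q.2 * rightAd F x ^ q.1) := by
  rw [exponentBox, sub_eq_iff_eq_add, nilExp_eq_sum hx, nilExp_eq_sum hy, sum_mul_sum, sum_comm,
    ← sum_product']
  have h := sum_erase_add (range M ×ˢ range M) (a := (0, 0))
    (fun q => ((q.1.factorial : F)⁻¹ * (q.2.factorial : F)⁻¹) •
      (rightAd F y ^ q.2 * rightAd F x ^ q.1)) (by simpa)
  simp only [Nat.factorial_zero, Nat.cast_one, inv_one, mul_one, pow_zero, one_smul] at h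
  rw [h]
  refine sum_congr rfl fun q _ => ?_
  rw [smul_mul_smul_comm, mul_comm (q.1.factorial : F)⁻¹]

/-- The commutators `[x, …, x, y, …, y]` vanish unless there is at most one `x`, and, without any
`x`, exactly one `y`. -/
theorem sum_leftNormed_singleton {x y : A} {M : ℕ} (hM : 2 ≤ M) (hy : rightAd F y ^ M = 0) :
    ∑ q ∈ exponentBox M, ((q.1.factorial : F)⁻¹ * (q.2.factorial : F)⁻¹) •
        leftNormed (bchWord x y [q]) = nilExp F (rightAd F y) x + y := by
  have hself : ∀ (z : A) n, leftNormed (List.replicate (n + 2) z) = 0 := by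
    intro z n
    rw [show n + 2 = 1 + (n + 1) by ring, ← List.replicate_append_replicate,
      leftNormed_append (by simp), foldl_lie_replicate (F := F), pow_succ, Module.End.mul_apply]
    simp [leftNormed, rightAd_apply]
  have hx : ∀ r s, leftNormed (bchWord x y [(r + 2, s)]) = 0 := by
    intro r s
    have : bchWord x y [(r + 2, s)] = List.replicate (r + 2) x ++ List.replicate s y := by
      simp [bchWord]
    rw [this, leftNormed_append (by simp), foldl_lie_replicate (F := F), hself, map_zero]
  have hx1 : ∀ s, leftNormed (bchWord x y [(1, s)]) = (rightAd F y ^ s) x := by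
    intro s
    have : bchWord x y [(1, s)] = [x] ++ List.replicate s y := by simp [bchWord]
    rw [this, leftNormed_append (by simp), foldl_lie_replicate (F := F)]
    rfl
  have hy2 : ∀ s, leftNormed (bchWord x y [(0, s + 2)]) = 0 := by
    intro s
    simpa [bchWord] using hself y s
  have hy1 : leftNormed (bchWord x y [(0, 1)]) = y := by simp [bchWord, leftNormed]
  have h00 : leftNormed (bchWord x y [(0, 0)]) = 0 := by simp [bchWord, leftNormed]
  rw [exponentBox, sum_erase _ (by rw [h00, smul_zero]), sum_product, nilExp_eq_sum hy,
    LinearMap.sum_apply]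
  obtain ⟨M, rfl⟩ := Nat.exists_eq_add_of_le' hM
  rw [sum_range_succ', sum_range_succ', sum_eq_zero, zero_add, zero_add]
  · congr 1
    · simp [hx1]
    · rw [sum_range_succ', sum_range_succ']
      simp [hy2, hy1, h00]
  · intro r _
    simp [hx]

/-- Appending a pair `(r, s)` to `p` brackets `leftNormed (bchWord x y p)` on the right with `r` times
`x` and `s` times `y`; summed over `(r, s)`, this is one more application of `exp y * exp x - 1`. -/
theorem pow_apply_eq_sum_leftNormed {x y : A} {M : ℕ} (hM : 2 ≤ M) (hx : rightAd F x ^ M = 0)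
    (hy : rightAd F y ^ M = 0) (k : ℕ) :
    ((nilExp F (rightAd F y) * nilExp F (rightAd F x) - 1) ^ k) (nilExp F (rightAd F y) x + y) =
      ∑ p ∈ listsOfLength (exponentBox M) (k + 1),
        factorialCoeff F p • leftNormed (bchWord x y p) := by
  induction k with
  | zero =>
    rw [sum_listsOfLength_succ, listsOfLength, sum_singleton, ← sum_leftNormed_singleton hM hy]
    simp [factorialCoeff]
  | succ k ih =>
    rw [pow_succ', Module.End.mul_apply, ih, sum_listsOfLength_succ _ (k + 1), map_sum]
    refine sum_congr rfl fun p hp => ?_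
    obtain ⟨hl, hp⟩ := mem_listsOfLength.1 hp
    have hp0 : (0, 0) ∉ p := fun h => by simpa [exponentBox] using hp _ h
    have hne : p ≠ [] := by rintro rfl; simp at hl
    rw [nilExp_rightAd_mul_sub_one_eq_sum (by lia) hx hy, map_smul, LinearMap.sum_apply, smul_sum]
    refine sum_congr rfl fun q _ => ?_
    have hq : bchWord x y [q] = List.replicate q.1 x ++ List.replicate q.2 y := by simp [bchWord]
    rw [bchWord_append, leftNormed_append (bchWord_ne_nil x y hp0 hne), hq, List.foldl_append,
      foldl_lie_replicate (F := F), foldl_lie_replicate (F := F), LinearMap.smul_apply, smul_smul]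
    simp [factorialCoeff]

/-- Dynkin's formula, up to the factors `∑ (rᵢ + sᵢ)` that the derivation `D` brings in. -/
theorem map_sum_bch_eq_map_nilLog (D : A →ₗ[F] A)
    (hD : ∀ a b, D (a * b) = D a * b + a * D b) {x y : A} (hx : IsNilpotent x) (hy : IsNilpotent y)
    (hg : IsNilpotent (nilExp F x * nilExp F y - 1)) (hDx : D x = x) (hDy : D y = y) :
    ∃ N, ∀ M, N ≤ M →
      D (∑ k ∈ range M, ∑ p ∈ listsOfLength (exponentBox M) (k + 1),
        bchCoeff F p • leftNormed (bchWord x y p)) = D (nilLog F (nilExp F x * nilExp F y)) := by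
  obtain ⟨⟨N₁, h₁⟩, h⟩ := nilEval_logQuot_eq_map_nilLog D hD hx hy hg hDx hDy
  obtain ⟨N₂, h₂⟩ := isNilpotent_rightAd (F := F) hx
  obtain ⟨N₃, h₃⟩ := isNilpotent_rightAd (F := F) hy
  refine ⟨N₁ + N₂ + N₃ + 2, fun M hM => ?_⟩
  rw [← h, nilEval_eq_sum (M := M) (pow_eq_zero_of_le (by lia) h₁), LinearMap.sum_apply, map_sum]
  refine sum_congr rfl fun k _ => ?_
  rw [LinearMap.smul_apply, pow_apply_eq_sum_leftNormed (M := M) (by lia)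
    (pow_eq_zero_of_le (by lia) h₂) (pow_eq_zero_of_le (by lia) h₃), map_sum, smul_sum]
  refine sum_congr rfl fun p hp => ?_
  obtain ⟨hl, hp⟩ := mem_listsOfLength.1 hp
  have hp0 : (0, 0) ∉ p := fun h => by simpa [exponentBox] using hp _ h
  have hne : p ≠ [] := by rintro rfl; simp at hl
  have hDw := map_leftNormed_of_derivation D.toAddMonoidHom hD (l := bchWord x y p) fun a ha => by
    rcases mem_bchWord ha with rfl | rfl <;> assumption
  have hDw : D (leftNormed (bchWord x y p)) = _ := hDw
  rw [map_smul, hDw, ← Nat.cast_smul_eq_nsmul F, smul_smul, bchCoeff_mul_length x y hp0 hne, hl,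
    smul_smul, logQuot, PowerSeries.coeff_mk]
  push_cast
  rw [pow_add, pow_add]
  norm_num

end Dynkin

/-! ### The Baker–Campbell–Hausdorff product in a nilpotent algebra -/

section Bch

open Finset

attribute [local instance] LieRing.ofAssociativeRing LieAlgebra.ofAssociativeAlgebra

variable {F A : Type*} [Field F] [Ring A] [Algebra F A]

theorem leftNormed_mem_pow {P : Submodule F A} {l : List A} (hl : ∀ a ∈ l, a ∈ P) :
    leftNormed l ∈ P ^ l.length := by
  induction l using List.reverseRecOn with
  | nil => simp [leftNormed]
  | append_singleton l a ih =>
    rcases eq_or_ne l [] with rfl | hne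
    · simpa [leftNormed] using hl a (by simp)
    · have h1 := ih fun b hb => hl b (by simp [hb])
      have h2 : a ∈ P := hl a (by simp)
      rw [leftNormed_append hne, List.foldl_cons, List.foldl_nil, Ring.lie_def, List.length_append,
        List.length_singleton]
      refine sub_mem ?_ ?_
      · rw [pow_succ]; exact Submodule.mul_mem_mul h1 h2
      · rw [pow_succ']; exact Submodule.mul_mem_mul h2 h1

theorem leftNormed_eq_zero {P : Submodule F A} {N : ℕ} (hP : P ^ N = ⊥) {l : List A}
    (hl : ∀ a ∈ l, a ∈ P) (hN : N ≤ l.length) : leftNormed l = 0 := by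
  have h := leftNormed_mem_pow hl
  obtain ⟨m, hm⟩ := Nat.exists_eq_add_of_le hN
  rw [hm, pow_add, hP, Submodule.bot_mul] at h
  simpa using h

/-- The sum in Dynkin's formula is finite if products of `N` elements vanish. -/
theorem bch_eq_sum {P : Submodule F A} {N M : ℕ} (hP : P ^ N = ⊥) (hM : N ≤ M) {u v : A}
    (hu : u ∈ P) (hv : v ∈ P) :
    bch F u v = ∑ k ∈ range M, ∑ p ∈ listsOfLength (exponentBox M) (k + 1),
      bchCoeff F p • leftNormed (bchWord u v p) := by
  have hdisj : ∀ i ∈ range M, ∀ j ∈ range M, i ≠ j → Disjoint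
      (listsOfLength (exponentBox M) (i + 1)) (listsOfLength (exponentBox M) (j + 1)) := by
    intro i _ j _ hij
    refine disjoint_left.2 fun p hp hp' => hij ?_
    have h1 := (mem_listsOfLength.1 hp).1
    have h2 := (mem_listsOfLength.1 hp').1
    lia
  rw [← sum_biUnion hdisj, bch]
  refine finsum_mem_eq_sum_of_inter_support_eq _ (Set.ext fun p => ?_)
  simp only [Set.mem_inter_iff, Set.mem_ofPred_eq, coe_biUnion, Set.mem_iUnion, mem_coe,
    mem_range, mem_listsOfLength, Function.mem_support, ne_eq, smul_eq_zero, not_or]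
  refine and_congr_left fun ⟨_, hp⟩ => ?_
  constructor
  · rintro ⟨hne, h0⟩
    have hlen : (bchWord u v p).length < M := by
      by_contra hc
      refine hp (leftNormed_eq_zero hP (fun a ha => ?_) (hM.trans (not_lt.1 hc)))
      rcases mem_bchWord ha with rfl | rfl <;> assumption
    have h1 := length_le_length_bchWord u v h0
    have h2 := List.length_pos_iff.2 hne
    refine ⟨p.length - 1, by lia, by lia, fun q hq => ?_⟩
    have h3 : q.1 + q.2 ≤ (bchWord u v p).length := by
      rw [length_bchWord]
      exact List.single_le_sum (by simp) _ (List.mem_map.2 ⟨q, hq, rfl⟩)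
    simp only [exponentBox, mem_erase, mem_product, mem_range]
    exact ⟨fun h => h0 (h ▸ hq), by lia, by lia⟩
  · rintro ⟨k, _, hk, hq⟩
    refine ⟨?_, fun h => by simpa [exponentBox] using hq _ h⟩
    rintro rfl
    simp at hk

/-- Evaluation of polynomials over a noncommutative algebra at a central element. -/
noncomputable def centralEval (F : Type*) {A : Type*} [Field F] [Ring A] [Algebra F A] (c : A)
    (hc : ∀ a, Commute a c) : Polynomial A →ₐ[F] A :=
  { Polynomial.eval₂RingHom' (RingHom.id A) c hc with
    commutes' := fun r => by
      change Polynomial.eval₂ (RingHom.id A) c (algebraMap F (Polynomial A) r) = _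
      rw [Polynomial.algebraMap_apply, Polynomial.eval₂_C, RingHom.id_apply] }

theorem centralEval_C_mul_X (c : A) (hc : ∀ a, Commute a c) (a : A) :
    centralEval F c hc (Polynomial.C a * Polynomial.X) = a * c := by
  change Polynomial.eval₂ (RingHom.id A) c _ = _
  rw [Polynomial.eval₂_mul_X, Polynomial.eval₂_C, RingHom.id_apply]

theorem centralEval_zero (hc : ∀ a : A, Commute a 0) (f : Polynomial A) :
    centralEval F 0 hc f = f.coeff 0 := by
  change Polynomial.eval₂ (RingHom.id A) 0 f = _
  simp [Polynomial.eval₂_eq_sum, Polynomial.sum_def, zero_pow_eq]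
  tauto

theorem coeff_pow_mem {P : Submodule F A} {f : Polynomial A} (hf : ∀ i, f.coeff i ∈ P) (n i : ℕ) :
    (f ^ n).coeff i ∈ P ^ n := by
  induction n generalizing i with
  | zero =>
    rw [pow_zero, pow_zero, Polynomial.coeff_one]
    split_ifs
    · exact Submodule.one_le.1 le_rfl
    · exact zero_mem _
  | succ n ih =>
    rw [pow_succ f, Polynomial.coeff_mul, pow_succ]
    exact sum_mem fun p _ => Submodule.mul_mem_mul (ih _) (hf _)

/-- In this form nilpotency passes to polynomials with coefficients in `P`, where it also makes sense
of `exp` and `log`. -/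
theorem isNilpotent_of_coeff_mem {P : Submodule F A} {N : ℕ} (hP : P ^ N = ⊥) {f : Polynomial A}
    (hf : ∀ i, f.coeff i ∈ P) : IsNilpotent f :=
  ⟨N, Polynomial.ext fun i => by simpa [hP] using coeff_pow_mem hf N i⟩

theorem isNilpotent_of_mem {P : Submodule F A} {N : ℕ} (hP : P ^ N = ⊥) {a : A} (ha : a ∈ P) :
    IsNilpotent a :=
  ⟨N, by simpa [hP] using Submodule.pow_mem_pow P ha N⟩

theorem pow_succ_mem {P : Submodule F A} (hPP : P * P ≤ P) {a : A} (ha : a ∈ P) (n : ℕ) :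
    a ^ (n + 1) ∈ P := by
  induction n with
  | zero => simpa
  | succ n ih => rw [pow_succ]; exact hPP (Submodule.mul_mem_mul ih ha)

theorem mul_sub_one_mem {P : Submodule F A} (hPP : P * P ≤ P) {g h : A} (hg : g - 1 ∈ P)
    (hh : h - 1 ∈ P) : g * h - 1 ∈ P := by
  have : g * h - 1 = (g - 1) * (h - 1) + (g - 1) + (h - 1) := by noncomm_ring
  rw [this]
  exact add_mem (add_mem (hPP (Submodule.mul_mem_mul hg hh)) hg) hh

variable [CharZero F]

theorem nilExp_sub_one_mem {P : Submodule F A} (hPP : P * P ≤ P) {N : ℕ} (hP : P ^ N = ⊥) {a : A}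
    (ha : a ∈ P) : nilExp F a - 1 ∈ P := by
  rw [nilExp_sub_one (isNilpotent_of_mem hP ha)]
  exact nilEval_mem (pow_succ_mem hPP ha) (by simp)

/-- In a nilpotent ideal the Baker–Campbell–Hausdorff product, defined by Dynkin's formula, is
`log (exp u * exp v)`. The degrees are separated by passing to `u X` and `v X` in the polynomial
ring, with the derivation `X d/dX`. -/
theorem bch_eq_nilLog {P : Submodule F A} (hPP : P * P ≤ P) {N : ℕ} (hP : P ^ N = ⊥) {u v : A}
    (hu : u ∈ P) (hv : v ∈ P) : bch F u v = nilLog F (nilExp F u * nilExp F v) := by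
  let D : Polynomial A →ₗ[F] Polynomial A :=
    LinearMap.mulLeft F Polynomial.X ∘ₗ (Polynomial.derivative (R := A)).restrictScalars F
  have hDa : ∀ f, D f = Polynomial.X * Polynomial.derivative f := fun f => rfl
  have hD : ∀ f g, D (f * g) = D f * g + f * D g := fun f g => by
    rw [hDa, hDa, hDa, Polynomial.derivative_mul, mul_add, mul_assoc, ← mul_assoc f,
      ← Polynomial.X_mul, mul_assoc]
  have hDX : ∀ a : A, D (Polynomial.C a * Polynomial.X) = Polynomial.C a * Polynomial.X := by
    intro a
    rw [hDa, Polynomial.derivative_mul, Polynomial.derivative_C, Polynomial.derivative_X, zero_mul,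
      zero_add, mul_one, Polynomial.X_mul]
  -- `Q` consists of the polynomials with coefficients in `P`.
  let Q : Submodule F (Polynomial A) :=
    { carrier := {f | ∀ i, f.coeff i ∈ P}
      add_mem' := fun hf hg i => by rw [Polynomial.coeff_add]; exact add_mem (hf i) (hg i)
      zero_mem' := fun i => by simp
      smul_mem' := fun c f hf i => by rw [Polynomial.coeff_smul]; exact P.smul_mem c (hf i) }
  have hQQ : Q * Q ≤ Q := Submodule.mul_le.2 fun f hf g hg i => by
    rw [Polynomial.coeff_mul]
    exact sum_mem fun p _ => hPP (Submodule.mul_mem_mul (hf _) (hg _))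
  have hQ : ∀ a ∈ P, Polynomial.C a * Polynomial.X ∈ Q := fun a ha i => by
    rw [Polynomial.coeff_C_mul, Polynomial.coeff_X]
    split_ifs <;> simp [ha]
  set x := Polynomial.C u * Polynomial.X with hx
  set y := Polynomial.C v * Polynomial.X with hy
  have hxn : IsNilpotent x := isNilpotent_of_coeff_mem hP (hQ u hu)
  have hyn : IsNilpotent y := isNilpotent_of_coeff_mem hP (hQ v hv)
  have hexp : ∀ z ∈ Q, nilExp F z - 1 ∈ Q := fun z hz => by
    rw [nilExp_sub_one (isNilpotent_of_coeff_mem hP hz)]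
    exact nilEval_mem (pow_succ_mem hQQ hz) (by simp)
  have hgn : IsNilpotent (nilExp F x * nilExp F y - 1) :=
    isNilpotent_of_coeff_mem hP (mul_sub_one_mem hQQ (hexp x (hQ u hu)) (hexp y (hQ v hv)))
  obtain ⟨M₀, hM₀⟩ := map_sum_bch_eq_map_nilLog D hD hxn hyn hgn (hDX u) (hDX v)
  have hM₀ := hM₀ (max M₀ N) (le_max_left _ _)
  have hbch := bch_eq_sum hP (le_max_right M₀ N) hu hv
  generalize max M₀ N = M at hM₀ hbch
  set S := ∑ k ∈ range M, ∑ p ∈ listsOfLength (exponentBox M) (k + 1),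
        bchCoeff F p • leftNormed (bchWord x y p) with hS
  have hc0 : ∀ a : A, Commute a 0 := Commute.zero_right
  have hc1 : ∀ a : A, Commute a 1 := Commute.one_right
  have hmapS : ∀ (c : A) (hc : ∀ a, Commute a c), centralEval F c hc S =
      ∑ k ∈ range M, ∑ p ∈ listsOfLength (exponentBox M) (k + 1),
        bchCoeff F p • leftNormed (bchWord (u * c) (v * c) p) := by
    intro c hc
    simp only [hS, map_sum, map_smul]
    refine sum_congr rfl fun k _ => sum_congr rfl fun p _ => ?_
    have h := map_leftNormed (centralEval F c hc).toAddMonoidHom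
      (fun f g => by
        change centralEval F c hc ⁅f, g⁆ = ⁅centralEval F c hc f, centralEval F c hc g⁆
        simp only [Ring.lie_def, map_sub, map_mul]) (bchWord x y p)
    rw [map_bchWord] at h
    refine congrArg (bchCoeff F p • ·) (h.trans ?_)
    change leftNormed (bchWord (centralEval F c hc x) (centralEval F c hc y) p) = _
    rw [hx, hy, centralEval_C_mul_X, centralEval_C_mul_X]
  have hmapL : ∀ (c : A) (hc : ∀ a, Commute a c),
      centralEval F c hc (nilLog F (nilExp F x * nilExp F y)) =
        nilLog F (nilExp F (u * c) * nilExp F (v * c)) := by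
    intro c hc
    rw [map_nilLog _ hgn, map_mul, map_nilExp _ hxn, map_nilExp _ hyn, hx, hy,
      centralEval_C_mul_X, centralEval_C_mul_X]
  -- `D` multiplies the coefficient of `Xⁱ` by `i`.
  have hcoeff : ∀ f : Polynomial A, D f = 0 → f.coeff 0 = 0 → f = 0 := by
    intro f hf h0
    ext i
    cases i with
    | zero => simpa using h0
    | succ i =>
      have h := congrArg (fun g => Polynomial.coeff g (i + 1)) hf
      simp only [hDa, Polynomial.coeff_X_mul, Polynomial.coeff_derivative, Polynomial.coeff_zero] at h
      have h' : ((i + 1 : ℕ) : F) • f.coeff (i + 1) = 0 := by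
        rw [Nat.cast_smul_eq_nsmul, nsmul_eq_mul, Nat.cast_comm]
        exact_mod_cast h
      exact (smul_eq_zero.1 h').resolve_left (Nat.cast_ne_zero.2 i.succ_ne_zero)
  have hzero : S - nilLog F (nilExp F x * nilExp F y) = 0 := by
    refine hcoeff _ (by rw [map_sub, hM₀, sub_self]) ?_
    rw [← centralEval_zero (F := F) hc0, map_sub, hmapS, hmapL]
    have hz : ∀ p : List (ℕ × ℕ), leftNormed (bchWord (u * 0) (v * 0) p) = 0 := by
      intro p
      have h := map_leftNormed (0 : A →+ A) (fun a b => by simp) (bchWord u v p)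
      rw [map_bchWord] at h
      simpa using h.symm
    simp only [hz, smul_zero, sum_const_zero]
    simp only [mul_zero, nilExp_zero, mul_one, nilLog, sub_self, nilEval_zero, zero_sub]
    simp
  -- Setting `X = 1` returns to `A`.
  have h1 := congrArg (centralEval F 1 hc1) hzero
  rw [map_sub, hmapS, hmapL, map_zero, sub_eq_zero] at h1
  simp only [mul_one] at h1
  rw [hbch, h1]

end Bch

/-! ### The group of a nilpotent algebra -/

section BchGroup

attribute [local instance] LieRing.ofAssociativeRing LieAlgebra.ofAssociativeAlgebra

variable (F : Type*) {R : Type*} [Field F] [NonUnitalRing R] [Module F R]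

/-- The inclusion of `[R]` into the unitization of `R`. -/
def toUnitization : CommutatorLie R →ₗ[F] Unitization F R := Unitization.inrHom F F R

theorem toUnitization_injective : Function.Injective (toUnitization F (R := R)) :=
  Unitization.inr_injective

variable [IsScalarTower F R R] [SMulCommClass F R R]

theorem toUnitization_lie (u v : CommutatorLie R) :
    toUnitization F ⁅u, v⁆ = ⁅toUnitization F u, toUnitization F v⁆ := by
  change ((u.val * v.val - v.val * u.val : R) : Unitization F R) = _
  rw [Unitization.inr_sub, Unitization.inr_mul, Unitization.inr_mul]
  rfl

theorem range_toUnitization_mul_le : LinearMap.range (toUnitization F (R := R)) *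
    LinearMap.range (toUnitization F (R := R)) ≤ LinearMap.range (toUnitization F (R := R)) := by
  refine Submodule.mul_le.2 ?_
  rintro _ ⟨u, rfl⟩ _ ⟨v, rfl⟩
  exact ⟨CommutatorLie.of (u.val * v.val), Unitization.inr_mul F u.val v.val⟩

theorem toUnitization_bch (u v : CommutatorLie R) :
    toUnitization F (bch F u v) = bch F (toUnitization F u) (toUnitization F v) := by
  rw [bch, bch]
  change (toUnitization F).toAddMonoidHom _ = _
  rw [AddMonoidHom.map_finsum_of_injective _ (toUnitization_injective F (R := R))]
  refine finsum_congr fun p => ?_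
  rw [AddMonoidHom.map_finsum_of_injective _ (toUnitization_injective F (R := R))]
  refine finsum_congr fun _ => ?_
  have h := map_leftNormed (toUnitization F).toAddMonoidHom (toUnitization_lie F) (bchWord u v p)
  rw [map_bchWord] at h
  exact ((toUnitization F).map_smul _ _).trans (congrArg _ h)

variable [CharZero F]

/-- For a nilpotent algebra `R` the Baker–Campbell–Hausdorff product is a group structure on `[R]`,
carried over from the multiplication of the elements `exp u` in the unitization. -/
theorem exists_group_mul_eq_bch {N : ℕ}
    (hN : LinearMap.range (toUnitization F (R := R)) ^ N = ⊥) :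
    ∃ _ : Group (CommutatorLie R), (∀ u v : CommutatorLie R, u * v = bch F u v) ∧
      ∃ φ : CommutatorLie R →* Unitization F R, ∀ u, φ u = nilExp F (toUnitization F u) := by
  set P := LinearMap.range (toUnitization F (R := R)) with hPdef
  have hPP : P * P ≤ P := range_toUnitization_mul_le F
  have hP : ∀ u, toUnitization F u ∈ P := fun u => ⟨u, rfl⟩
  have hn : ∀ u : CommutatorLie R, IsNilpotent (toUnitization F u) :=
    fun u => isNilpotent_of_mem hN (hP u)
  have hmul : ∀ u v : CommutatorLie R, nilExp F (toUnitization F (bch F u v)) =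
      nilExp F (toUnitization F u) * nilExp F (toUnitization F v) := by
    intro u v
    rw [toUnitization_bch, bch_eq_nilLog hPP hN (hP u) (hP v), nilExp_nilLog]
    exact isNilpotent_of_mem hN
      (mul_sub_one_mem hPP (nilExp_sub_one_mem hPP hN (hP u)) (nilExp_sub_one_mem hPP hN (hP v)))
  have hinj : Function.Injective fun u : CommutatorLie R => nilExp F (toUnitization F u) := by
    intro u v h
    have h := congrArg (nilLog F) h
    simp only [nilLog_nilExp (hn _)] at h
    exact toUnitization_injective F h
  let : Mul (CommutatorLie R) := ⟨bch F⟩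
  let : One (CommutatorLie R) := ⟨0⟩
  let : Inv (CommutatorLie R) := ⟨fun u => -u⟩
  have h1 : nilExp F (toUnitization F (1 : CommutatorLie R)) = 1 := by
    change nilExp F (toUnitization F (0 : CommutatorLie R)) = 1
    rw [map_zero, nilExp_zero]
  have hm : ∀ u v : CommutatorLie R, nilExp F (toUnitization F (u * v)) =
      nilExp F (toUnitization F u) * nilExp F (toUnitization F v) := hmul
  let G : Group (CommutatorLie R) := Group.ofLeftAxioms
    (fun u v w => hinj (by simp only [hm, mul_assoc]))
    (fun u => hinj (by simp only [hm, h1, one_mul]))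
    (fun u => hinj (by
      simp only [hm, h1]
      change nilExp F (toUnitization F (-u)) * _ = 1
      rw [map_neg, nilExp_neg_mul_nilExp (hn u)]))
  exact ⟨G, fun u v => rfl,
    { toFun := fun u => nilExp F (toUnitization F u), map_one' := h1, map_mul' := hm }, fun u => rfl⟩

end BchGroup

/-! ### Words in the algebra `B` -/

theorem mul_sub_mul_mem_pow_succ {F A : Type*} [Field F] [Ring A] [Algebra F A]
    {P : Submodule F A} {a b : A} {n : ℕ} (ha : a ∈ P) (hb : b ∈ P ^ n) :
    a * b - b * a ∈ P ^ (n + 1) := by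
  refine sub_mem ?_ ?_
  · rw [pow_succ']; exact Submodule.mul_mem_mul ha hb
  · rw [pow_succ]; exact Submodule.mul_mem_mul hb ha

section Words

open Finset

/-- The letters of `y x y³ x y`. -/
abbrev lettersW₁ : List (Fin 2) := [1, 0, 1, 1, 1, 0, 1]

/-- The letters of `y² x y x y²`. -/
abbrev lettersW₂ : List (Fin 2) := [1, 1, 0, 1, 0, 1, 1]

theorem letters_mul (m n : Mon) : (m * n).letters = m.letters ++ n.letters := rfl

theorem letters_injective : Function.Injective Mon.letters := by
  rintro ⟨a, l⟩ ⟨b, l'⟩ h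
  simp only [Mon.letters, List.cons.injEq] at h
  rw [h.1, h.2]

theorem exists_letters_eq {l : List (Fin 2)} (hl : l ≠ []) : ∃ m : Mon, m.letters = l := by
  cases l with
  | nil => exact (hl rfl).elim
  | cons a l => exact ⟨⟨a, l⟩, rfl⟩

theorem letters_W₁ : Mon.W₁.letters = lettersW₁ := rfl

theorem letters_W₂ : Mon.W₂.letters = lettersW₂ := rfl

theorem divides_iff (m n : Mon) : m.Divides n ↔ m.letters <:+: n.letters := by
  constructor
  · rintro ⟨s, t, h⟩
    exact ⟨s, t, h.symm⟩
  · rintro ⟨s, t, h⟩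
    exact ⟨s, t, h.symm⟩

variable (F : Type*) [Field F]

/-- The projection `A → B`, into the unitization of `B`. -/
noncomputable def projB : FreeA F →ₗ[F] Unitization F (AlgB F) :=
  Unitization.inrHom F F (AlgB F) ∘ₗ AlgQuotient.mk (FreeA.gens F)

theorem projB_mul (a b : FreeA F) : projB F (a * b) = projB F a * projB F b := by
  change ((AlgQuotient.mk (F := F) (FreeA.gens F) (a * b) : AlgB F) : Unitization F (AlgB F)) = _
  rw [AlgQuotient.mk_mul]
  exact Unitization.inr_mul F (A := AlgB F) _ _

/-- A possibly empty word in the letters `x`, `y`, in the unitization of `B`. -/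
noncomputable def wordB (l : List (Fin 2)) : Unitization F (AlgB F) :=
  (l.map fun i => projB F (FreeA.mon F (FreeSemigroup.of i))).prod

theorem wordB_append (l l' : List (Fin 2)) : wordB F (l ++ l') = wordB F l * wordB F l' := by
  simp [wordB]

theorem wordB_nil : wordB F [] = 1 := rfl

theorem mon_mul (m n : Mon) : FreeA.mon F m * FreeA.mon F n = FreeA.mon F (m * n) := by
  rw [FreeA.mon, FreeA.mon, FreeA.mon, MonoidAlgebra.single_mul_single, one_mul]

theorem single_eq_smul_mon (m : Mon) (r : F) :
    MonoidAlgebra.single m r = r • FreeA.mon F m := by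
  rw [FreeA.mon, MonoidAlgebra.smul_single, smul_eq_mul, mul_one]

theorem projB_mon (m : Mon) : projB F (FreeA.mon F m) = wordB F m.letters := by
  induction m using FreeSemigroup.recOnMul with
  | ih1 i => simp [wordB, Mon.letters, FreeSemigroup.of]
  | ih2 i m h1 h2 =>
    rw [letters_mul, wordB_append, ← h1, ← h2, ← projB_mul, mon_mul]

variable {F}

theorem subset_algIdealSpan {R : Type*} [NonUnitalRing R] [Module F R] (S : Set R) :
    S ⊆ algIdealSpan F S := fun a ha => by
  simp only [algIdealSpan, SetLike.mem_coe, Submodule.mem_sInf]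
  exact fun J hJ => hJ.1 ha

theorem mk_eq_zero_of_mem {R : Type*} [NonUnitalRing R] [Module F R] {S : Set R} {a : R}
    (ha : a ∈ S) : AlgQuotient.mk (F := F) S a = 0 := by
  rw [← map_zero (AlgQuotient.mk (F := F) S), AlgQuotient.mk_eq_mk, sub_zero]
  exact subset_algIdealSpan S ha

theorem projB_eq_zero_of_mem {a : FreeA F} (h : a ∈ FreeA.gens F) : projB F a = 0 := by
  rw [projB, LinearMap.comp_apply, mk_eq_zero_of_mem h, map_zero]

/-- A word vanishes in `B` unless it divides `y x y³ x y` or `y² x y x y²`. -/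
theorem wordB_eq_zero {l : List (Fin 2)} (h₁ : ¬ l <:+: lettersW₁) (h₂ : ¬ l <:+: lettersW₂) :
    wordB F l = 0 := by
  rcases lt_or_ge l.length 8 with hl | hl
  · obtain ⟨m, rfl⟩ := exists_letters_eq (l := l) (by rintro rfl; exact h₁ (List.nil_infix))
    rw [← projB_mon]
    refine projB_eq_zero_of_mem ?_
    rw [← letters_W₁, ← divides_iff] at h₁
    rw [← letters_W₂, ← divides_iff] at h₂
    have hne : ∀ n : Mon, ¬ m.Divides n → m ≠ n := by
      rintro n h rfl
      exact h ((divides_iff _ _).2 List.infix_rfl)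
    rcases Nat.lt_succ_iff_lt_or_eq.1 hl with hl | hl
    · exact Or.inl (Or.inr ⟨m, ⟨hl, h₁, h₂⟩, rfl⟩)
    · exact Or.inl (Or.inl (Or.inr ⟨m, ⟨hl, hne _ h₁, hne _ h₂⟩, rfl⟩))
  · have h8 : (l.take 8).length = 8 := by simp [hl]
    obtain ⟨m, hm⟩ := exists_letters_eq (l := l.take 8) (by intro h; simp [h] at h8)
    rw [← List.take_append_drop 8 l, wordB_append, ← hm, ← projB_mon, projB_eq_zero_of_mem, zero_mul]
    exact Or.inl (Or.inl (Or.inl (Or.inl ⟨m, show m.letters.length = 8 by rw [hm, h8], rfl⟩)))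

theorem wordB_relation_six :
    (2 : F) • wordB F [0, 1, 1, 1, 0, 1] - (5 : F) • wordB F [1, 0, 1, 0, 1, 1]
      - (2 : F) • wordB F [1, 0, 1, 1, 1, 0] + (5 : F) • wordB F [1, 1, 0, 1, 0, 1] = 0 := by
  have h : projB F (FreeA.h₁ F) = 0 :=
    projB_eq_zero_of_mem (Set.mem_union_right _ (Set.mem_insert _ _))
  simp only [FreeA.h₁, map_add, map_sub, map_smul, projB_mul, projB_mon, ← wordB_append] at h
  exact h

theorem wordB_relation_seven : (2 : F) • wordB F lettersW₁ - (5 : F) • wordB F lettersW₂ = 0 := by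
  have h : projB F (FreeA.h₂ F) = 0 :=
    projB_eq_zero_of_mem (Set.mem_union_right _ (Set.mem_insert_of_mem _ rfl))
  simp only [FreeA.h₂, map_sub, map_smul, projB_mul, projB_mon, ← wordB_append] at h
  exact h

/-- The span of the words in a given set. -/
noncomputable def wordSpan (F : Type*) [Field F] (s : Set (List (Fin 2))) :
    Submodule F (Unitization F (AlgB F)) :=
  Submodule.span F (wordB F '' s)

theorem wordB_mem_wordSpan {s : Set (List (Fin 2))} {l : List (Fin 2)} (hl : l ∈ s) :
    wordB F l ∈ wordSpan F s := Submodule.subset_span ⟨l, hl, rfl⟩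

theorem wordSpan_le {s : Set (List (Fin 2))} {Q : Submodule F (Unitization F (AlgB F))}
    (h : ∀ l ∈ s, wordB F l ∈ Q) : wordSpan F s ≤ Q :=
  Submodule.span_le.2 (by rintro _ ⟨l, hl, rfl⟩; exact h l hl)

theorem wordSpan_mul_le {s t r : Set (List (Fin 2))} (h : ∀ l ∈ s, ∀ l' ∈ t, l ++ l' ∈ r) :
    wordSpan F s * wordSpan F t ≤ wordSpan F r := by
  rw [wordSpan, wordSpan, Submodule.span_mul_span, Submodule.span_le]
  rintro _ ⟨_, ⟨l, hl, rfl⟩, _, ⟨l', hl', rfl⟩, rfl⟩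
  change wordB F l * wordB F l' ∈ _
  rw [← wordB_append]
  exact wordB_mem_wordSpan (h l hl l' hl')

theorem wordSpan_eq_bot {s : Set (List (Fin 2))}
    (h : ∀ l ∈ s, ¬ l <:+: lettersW₁ ∧ ¬ l <:+: lettersW₂) : wordSpan F s = ⊥ :=
  (Submodule.eq_bot_iff _).2 fun a ha => by
    have := wordSpan_le (Q := ⊥) (fun l hl => (Submodule.mem_bot F).2 (wordB_eq_zero (h l hl).1 (h l hl).2)) ha
    simpa using this

theorem projB_eq_sum (a : FreeA F) :
    projB F a = a.coeff.sum fun m r => r • wordB F m.letters := by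
  induction a using MonoidAlgebra.induction_linear with
  | zero => simp
  | add a b ha hb =>
    rw [map_add, ha, hb, MonoidAlgebra.coeff_add, Finsupp.sum_add_index' (by simp)
      (fun _ _ _ => add_smul _ _ _)]
  | single m r =>
    rw [single_eq_smul_mon, map_smul, projB_mon, FreeA.mon, MonoidAlgebra.coeff_smul]
    simp [MonoidAlgebra.coeff_single]

theorem range_toUnitization_le : LinearMap.range (toUnitization F (R := AlgB F)) ≤
    wordSpan F {l | 1 ≤ l.length} := by
  rintro _ ⟨u, rfl⟩
  obtain ⟨a, ha⟩ := AlgQuotient.mk_surjective (F := F) (FreeA.gens F) u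
  have h : toUnitization F u = projB F a := congrArg (toUnitization F (R := AlgB F)) ha.symm
  rw [h, projB_eq_sum]
  refine sum_mem fun m _ => Submodule.smul_mem _ _ (wordB_mem_wordSpan ?_)
  simp [Mon.letters]

theorem range_toUnitization_pow_le (n : ℕ) :
    LinearMap.range (toUnitization F (R := AlgB F)) ^ n ≤ wordSpan F {l | n ≤ l.length} := by
  induction n with
  | zero =>
    rw [pow_zero, Submodule.one_le, ← wordB_nil]
    exact wordB_mem_wordSpan (by simp)
  | succ n ih =>
    rw [pow_succ]
    refine (mul_le_mul' ih range_toUnitization_le).trans (wordSpan_mul_le fun l hl l' hl' => ?_)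
    simp only [Set.mem_ofPred_eq, List.length_append] at hl hl' ⊢
    lia

/-- `B⁸ = 0`. -/
theorem range_toUnitization_pow_eight :
    LinearMap.range (toUnitization F (R := AlgB F)) ^ 8 = ⊥ := by
  refine le_bot_iff.1 ((range_toUnitization_pow_le 8).trans (wordSpan_eq_bot fun l hl => ?_).le)
  simp only [Set.mem_ofPred_eq] at hl
  constructor <;> intro h <;> have := h.length_le <;> simp at this <;> lia

theorem isNilpotent_commutatorLie_algB (F : Type*) [Field F] :
    LieRing.IsNilpotent (CommutatorLie (AlgB F)) := by
  have key : ∀ k, ∀ u ∈ LieModule.lowerCentralSeries F (CommutatorLie (AlgB F))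
      (CommutatorLie (AlgB F)) k,
      toUnitization F u ∈ LinearMap.range (toUnitization F (R := AlgB F)) ^ (k + 1) := by
    intro k
    induction k with
    | zero => intro u _; rw [zero_add, pow_one]; exact ⟨u, rfl⟩
    | succ k ih =>
      intro u hu
      rw [LieModule.lowerCentralSeries_succ, ← LieSubmodule.mem_toSubmodule,
        LieSubmodule.lieIdeal_oper_eq_linear_span'] at hu
      induction hu using Submodule.span_induction with
      | mem u hu =>
        obtain ⟨x, _, n, hn, rfl⟩ := hu
        have hx : toUnitization F x ∈ LinearMap.range (toUnitization F (R := AlgB F)) := ⟨x, rfl⟩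
        rw [toUnitization_lie, Ring.lie_def]
        exact mul_sub_mul_mem_pow_succ hx (ih n hn)
      | zero => rw [map_zero]; exact zero_mem _
      | add u v _ _ hu hv => rw [map_add]; exact add_mem hu hv
      | smul c u _ hu => rw [map_smul]; exact Submodule.smul_mem _ _ hu
  rw [LieRing.IsNilpotent, LieModule.isNilpotent_iff F]
  refine ⟨7, (LieSubmodule.eq_bot_iff _).2 fun u hu => toUnitization_injective F ?_⟩
  have h := key 7 u hu
  rw [range_toUnitization_pow_eight, Submodule.mem_bot] at h
  rw [h, map_zero]

end Words

/-! ### The `5`-Engel identity -/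

section Engel

open Finset

variable {F : Type*} [Field F]

/-- The coefficient of a word in an element of `A`; it is `0` for the empty word. -/
def coeffWord (a : FreeA F) : List (Fin 2) → F
  | [] => 0
  | i :: l => a.coeff ⟨i, l⟩

theorem coeffWord_nil (a : FreeA F) : coeffWord a [] = 0 := rfl

theorem coeffWord_letters (a : FreeA F) (m : Mon) : coeffWord a m.letters = a.coeff m := rfl

theorem coeffWord_zero (l : List (Fin 2)) : coeffWord (0 : FreeA F) l = 0 := by
  cases l <;> rfl

theorem coeffWord_add (a b : FreeA F) (l : List (Fin 2)) :
    coeffWord (a + b) l = coeffWord a l + coeffWord b l := by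
  cases l
  · simp [coeffWord]
  · rfl

theorem coeffWord_sub (a b : FreeA F) (l : List (Fin 2)) :
    coeffWord (a - b) l = coeffWord a l - coeffWord b l := by
  rw [eq_sub_iff_add_eq, ← coeffWord_add, sub_add_cancel]

theorem coeffWord_single (m : Mon) (r : F) (l : List (Fin 2)) :
    coeffWord (MonoidAlgebra.single m r) l = if m.letters = l then r else 0 := by
  rcases eq_or_ne l [] with rfl | hl
  · simp [coeffWord, Mon.letters]
  · obtain ⟨n, rfl⟩ := exists_letters_eq hl
    rw [coeffWord_letters, MonoidAlgebra.coeff_single, Finsupp.single_apply]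
    simp only [letters_injective.eq_iff]

theorem coeffWord_mul (a b : FreeA F) (l : List (Fin 2)) :
    coeffWord (a * b) l =
      ∑ i ∈ range (l.length + 1), coeffWord a (l.take i) * coeffWord b (l.drop i) := by
  induction a using MonoidAlgebra.induction_linear with
  | zero => simp [coeffWord_zero]
  | add a a' h h' => simp only [add_mul, coeffWord_add, h, h', sum_add_distrib]
  | single m r =>
    induction b using MonoidAlgebra.induction_linear with
    | zero => simp [coeffWord_zero]
    | add b b' h h' => simp only [mul_add, coeffWord_add, h, h', sum_add_distrib]
    | single n s =>
      rw [MonoidAlgebra.single_mul_single]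
      simp only [coeffWord_single]
      by_cases h : (m * n).letters = l
      · subst h
        rw [if_pos rfl, letters_mul, sum_eq_single m.letters.length]
        · simp
        · intro i hi hne
          rw [if_neg, zero_mul]
          intro h
          have := congrArg List.length h
          simp only [List.length_take, List.length_append] at this
          simp only [List.length_append, mem_range] at hi
          lia
        · simp
      · rw [if_neg h, sum_eq_zero]
        intro i _
        rw [ite_mul, zero_mul, mul_ite, mul_zero]
        split_ifs with h1 h2
        · exact (h (by rw [letters_mul, h1, h2, List.take_append_drop])).elim
        · rfl
        · rfl

/-- The left-normed commutator `[a, b, …, b]` in `A`, with `n` times `b`. -/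
noncomputable def engelWord (a b : FreeA F) (n : ℕ) : FreeA F := (fun w => w * b - b * w)^[n] a

theorem engelWord_succ (a b : FreeA F) (n : ℕ) :
    engelWord a b (n + 1) = engelWord a b n * b - b * engelWord a b n :=
  Function.iterate_succ_apply' _ n a

theorem coeffWord_engelWord_of_length_le (a b : FreeA F) {n : ℕ} {l : List (Fin 2)}
    (hl : l.length ≤ n) : coeffWord (engelWord a b n) l = 0 := by
  induction n generalizing l with
  | zero => rw [List.length_eq_zero_iff.1 (Nat.le_zero.1 hl)]; rfl
  | succ n ih =>
    rw [engelWord_succ, coeffWord_sub, coeffWord_mul, coeffWord_mul, sum_eq_zero, sum_eq_zero,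
      sub_zero]
    · intro i _
      rcases Nat.eq_zero_or_pos i with rfl | hi
      · simp [coeffWord_nil]
      · rw [ih (by rw [List.length_drop]; lia), mul_zero]
    · intro i _
      rcases lt_or_ge i l.length with hi | hi
      · rw [ih (by rw [List.length_take]; lia), zero_mul]
      · rw [List.drop_eq_nil_of_le hi, coeffWord_nil, mul_zero]

/-- The lowest homogeneous component of `[a, b, …, b]`. -/
theorem coeffWord_engelWord_low (a b : FreeA F) {n : ℕ} {l : List (Fin 2)}
    (hl : l.length = n + 2) : coeffWord (engelWord a b (n + 1)) l =
      coeffWord (engelWord a b n) (l.take (n + 1)) * coeffWord b (l.drop (n + 1)) -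
      coeffWord b (l.take 1) * coeffWord (engelWord a b n) (l.drop 1) := by
  rw [engelWord_succ, coeffWord_sub, coeffWord_mul, coeffWord_mul, sum_eq_single (n + 1),
    sum_eq_single 1]
  · intro i _ hi
    rcases Nat.eq_zero_or_pos i with rfl | hi'
    · simp [coeffWord_nil]
    · rw [coeffWord_engelWord_of_length_le _ _ (l := l.drop i) (by rw [List.length_drop]; lia),
        mul_zero]
  · exact fun h => absurd (mem_range.2 (by lia)) h
  · intro i hi' hi
    rcases lt_or_ge i (n + 1) with h | h
    · rw [coeffWord_engelWord_of_length_le _ _ (by rw [List.length_take]; lia), zero_mul]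
    · rw [List.drop_eq_nil_of_le (by lia), coeffWord_nil, mul_zero]
  · exact fun h => absurd (mem_range.2 (by lia)) h

/-- The homogeneous component of `[a, b, …, b]` of the lowest degree but one. -/
theorem coeffWord_engelWord_next (a b : FreeA F) {n : ℕ} {l : List (Fin 2)}
    (hl : l.length = n + 3) : coeffWord (engelWord a b (n + 1)) l =
      coeffWord (engelWord a b n) (l.take (n + 1)) * coeffWord b (l.drop (n + 1)) +
      coeffWord (engelWord a b n) (l.take (n + 2)) * coeffWord b (l.drop (n + 2)) -
      (coeffWord b (l.take 1) * coeffWord (engelWord a b n) (l.drop 1) +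
      coeffWord b (l.take 2) * coeffWord (engelWord a b n) (l.drop 2)) := by
  rw [engelWord_succ, coeffWord_sub, coeffWord_mul, coeffWord_mul,
    ← sum_subset (s₁ := {n + 1, n + 2}), sum_pair (by lia), ← sum_subset (s₁ := {1, 2}),
    sum_pair (by lia)]
  · intro i; simp; lia
  · intro i _ hi
    simp only [mem_insert, mem_singleton, not_or] at hi
    rcases Nat.eq_zero_or_pos i with rfl | hi'
    · simp [coeffWord_nil]
    · rw [coeffWord_engelWord_of_length_le _ _ (l := l.drop i) (by rw [List.length_drop]; lia),
        mul_zero]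
  · intro i; simp; lia
  · intro i hi' hi
    simp only [mem_insert, mem_singleton, not_or] at hi
    rcases lt_or_ge i (n + 1) with h | h
    · rw [coeffWord_engelWord_of_length_le _ _ (by rw [List.length_take]; lia), zero_mul]
    · rw [List.drop_eq_nil_of_le (by lia), coeffWord_nil, mul_zero]

/-- The component of degree `6` of `[a, b, b, b, b, b]` is, on the words that survive in `B`,
proportional to the relation `h₁`. -/
theorem coeffWord_engelWord_six (a b : FreeA F) :
    5 * coeffWord (engelWord a b 5) [0, 1, 1, 1, 0, 1] =
        -2 * coeffWord (engelWord a b 5) [1, 0, 1, 0, 1, 1] ∧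
    coeffWord (engelWord a b 5) [1, 0, 1, 1, 1, 0] =
        -coeffWord (engelWord a b 5) [0, 1, 1, 1, 0, 1] ∧
    coeffWord (engelWord a b 5) [1, 1, 0, 1, 0, 1] =
        -coeffWord (engelWord a b 5) [1, 0, 1, 0, 1, 1] := by
  have h0 : ∀ l, coeffWord (engelWord a b 0) l = coeffWord a l := fun _ => rfl
  simp [coeffWord_engelWord_low, h0]
  refine ⟨by ring, by ring, by ring⟩

/-- The component of degree `7` of `[a, b, b, b, b, b]` is, on the words that survive in `B`,
proportional to the relation `h₂`. -/
theorem coeffWord_engelWord_seven (a b : FreeA F) :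
    5 * coeffWord (engelWord a b 5) lettersW₁ + 2 * coeffWord (engelWord a b 5) lettersW₂ = 0 := by
  have h0 : ∀ l, coeffWord (engelWord a b 0) l = coeffWord a l := fun _ => rfl
  simp [coeffWord_engelWord_low, coeffWord_engelWord_next, h0]
  ring

theorem mem_flatMap_inits_of_infix {α : Type*} {l w : List α} (h : l <:+: w) :
    l ∈ w.tails.flatMap List.inits := by
  obtain ⟨t, h1, h2⟩ := List.infix_iff_prefix_suffix.1 h
  exact List.mem_flatMap.2 ⟨t, (List.mem_tails _ _).2 h2, (List.mem_inits _ _).2 h1⟩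

/-- The words of length `6` and `7` that do not vanish in `B`. -/
abbrev longWords : List (List (Fin 2)) :=
  [[0, 1, 1, 1, 0, 1], [1, 0, 1, 0, 1, 1], [1, 0, 1, 1, 1, 0], [1, 1, 0, 1, 0, 1],
    lettersW₁, lettersW₂]

theorem wordB_eq_zero_of_six_le {l : List (Fin 2)} (h : 6 ≤ l.length) (hl : l ∉ longWords) :
    wordB F l = 0 := by
  have h1 : ∀ l ∈ lettersW₁.tails.flatMap List.inits, 6 ≤ l.length → l ∈ longWords := by decide
  have h2 : ∀ l ∈ lettersW₂.tails.flatMap List.inits, 6 ≤ l.length → l ∈ longWords := by decide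
  exact wordB_eq_zero (fun hi => hl (h1 l (mem_flatMap_inits_of_infix hi) h))
    (fun hi => hl (h2 l (mem_flatMap_inits_of_infix hi) h))

theorem projB_eq_sum_longWords {a : FreeA F} (ha : ∀ l, l.length ≤ 5 → coeffWord a l = 0) :
    projB F a = (longWords.map fun l => coeffWord a l • wordB F l).sum := by
  let T : Finset Mon := {⟨0, [1, 1, 1, 0, 1]⟩, ⟨1, [0, 1, 0, 1, 1]⟩, ⟨1, [0, 1, 1, 1, 0]⟩,
    ⟨1, [1, 0, 1, 0, 1]⟩, ⟨1, [0, 1, 1, 1, 0, 1]⟩, ⟨1, [1, 0, 1, 0, 1, 1]⟩}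
  have hT : ∀ m : Mon, m.letters ∈ longWords → m ∈ T := by
    rintro ⟨i, l⟩ h
    simpa [Mon.letters, T, FreeSemigroup.mk.injEq] using h
  rw [projB_eq_sum, Finsupp.sum, sum_subset (subset_union_left (s₂ := T)),
    ← sum_subset (subset_union_right (s₁ := a.coeff.support) (s₂ := T))]
  · simp [T, Mon.letters, coeffWord, FreeSemigroup.mk.injEq]
  · intro m _ hm
    rcases le_or_gt m.letters.length 5 with h | h
    · rw [← coeffWord_letters, ha _ h, zero_smul]
    · rw [wordB_eq_zero_of_six_le h (mt (hT m) hm), smul_zero]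
  · intro m _ hm
    rw [Finsupp.notMem_support_iff.1 hm, zero_smul]

theorem projB_engelWord_eq_zero [CharZero F] (a b : FreeA F) : projB F (engelWord a b 5) = 0 := by
  rw [projB_eq_sum_longWords fun l hl => coeffWord_engelWord_of_length_le a b hl]
  obtain ⟨h1, h2, h3⟩ := coeffWord_engelWord_six a b
  have h7 := coeffWord_engelWord_seven a b
  have r6 := wordB_relation_six (F := F)
  have r7 := wordB_relation_seven (F := F)
  simp only [longWords, List.map_cons, List.map_nil, List.sum_cons, List.sum_nil, add_zero]
  rw [h2, h3]
  generalize coeffWord (engelWord a b 5) [0, 1, 1, 1, 0, 1] = s at *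
  generalize coeffWord (engelWord a b 5) [1, 0, 1, 0, 1, 1] = t at *
  generalize coeffWord (engelWord a b 5) lettersW₁ = p at *
  generalize coeffWord (engelWord a b 5) lettersW₂ = q at *
  have ht : t = -(5 / 2) * s := by linear_combination (1 / 2) * h1
  have hq : q = -(5 / 2) * p := by linear_combination (1 / 2) * h7
  rw [ht, hq]
  linear_combination (norm := module) (s / 2) • r6 + (p / 2) • r7

theorem isEngelLie_algB (F : Type*) [Field F] [CharZero F] :
    IsEngelLie (CommutatorLie (AlgB F)) 5 := by
  intro u v
  obtain ⟨a, ha⟩ := AlgQuotient.mk_surjective (F := F) (FreeA.gens F) u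
  obtain ⟨b, hb⟩ := AlgQuotient.mk_surjective (F := F) (FreeA.gens F) v
  refine toUnitization_injective F ?_
  have h : ∀ n, toUnitization F ((fun w => ⁅w, v⁆)^[n] u) = projB F (engelWord a b n) := by
    have hbv : toUnitization F v = projB F b := congrArg (toUnitization F (R := AlgB F)) hb.symm
    intro n
    induction n with
    | zero => exact congrArg (toUnitization F (R := AlgB F)) ha.symm
    | succ n ih =>
      rw [Function.iterate_succ_apply', toUnitization_lie, Ring.lie_def, ih, hbv, engelWord_succ,
        map_sub, projB_mul, projB_mul]
  rw [h, projB_engelWord_eq_zero, map_zero]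

end Engel

/-! ### The word `y² x y x y²` does not vanish in `B` -/

section NonVanishing

variable (F : Type*) [Field F]

/-- The function on words that the relation `2 y x y³ x y = 5 y² x y x y²` leaves, up to a factor,
on the component of degree `7`. -/
def topWeight (l : List (Fin 2)) : F :=
  if l = lettersW₁ then 5 else if l = lettersW₂ then 2 else 0

/-- The linear functional `a ↦ topWeight (p a q)` on `A`. -/
noncomputable def topFunctional (p q : List (Fin 2)) : FreeA F →ₗ[F] F :=
  Finsupp.linearCombination F (fun m : Mon => topWeight F (p ++ m.letters ++ q)) ∘ₗ
    (MonoidAlgebra.coeffLinearEquiv F).toLinearMap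

variable {F}

theorem topFunctional_mon (p q : List (Fin 2)) (m : Mon) :
    topFunctional F p q (FreeA.mon F m) = topWeight F (p ++ m.letters ++ q) := by
  simp [topFunctional, FreeA.mon]

theorem topFunctional_mon_mul (p q : List (Fin 2)) (m : Mon) (a : FreeA F) :
    topFunctional F p q (FreeA.mon F m * a) = topFunctional F (p ++ m.letters) q a := by
  induction a using MonoidAlgebra.induction_linear with
  | zero => simp
  | add a b ha hb => rw [mul_add, map_add, ha, hb, map_add]
  | single n r =>
    rw [single_eq_smul_mon, mul_smul_comm, map_smul, map_smul, mon_mul, topFunctional_mon,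
      topFunctional_mon, letters_mul]
    simp only [List.append_assoc]

theorem topFunctional_mul_mon (p q : List (Fin 2)) (m : Mon) (a : FreeA F) :
    topFunctional F p q (a * FreeA.mon F m) = topFunctional F p (m.letters ++ q) a := by
  induction a using MonoidAlgebra.induction_linear with
  | zero => simp
  | add a b ha hb => rw [add_mul, map_add, ha, hb, map_add]
  | single n r =>
    rw [single_eq_smul_mon, smul_mul_assoc, map_smul, map_smul, mon_mul, topFunctional_mon,
      topFunctional_mon, letters_mul]
    simp only [List.append_assoc]

theorem topWeight_eq_zero {l : List (Fin 2)} (h : ¬ l <:+: lettersW₁) (h' : ¬ l <:+: lettersW₂)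
    (p q : List (Fin 2)) : topWeight F (p ++ l ++ q) = 0 := by
  rw [topWeight, if_neg fun e => h ⟨p, q, e⟩, if_neg fun e => h' ⟨p, q, e⟩]

theorem topFunctional_h₁ (p q : List (Fin 2)) : topFunctional F p q (FreeA.h₁ F) = 0 := by
  simp only [FreeA.h₁, mon_mul, map_add, map_sub, map_smul, topFunctional_mon]
  change (2 : F) • topWeight F (p ++ [0, 1, 1, 1, 0, 1] ++ q) -
    (5 : F) • topWeight F (p ++ [1, 0, 1, 0, 1, 1] ++ q) -
    (2 : F) • topWeight F (p ++ [1, 0, 1, 1, 1, 0] ++ q) +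
    (5 : F) • topWeight F (p ++ [1, 1, 0, 1, 0, 1] ++ q) = 0
  -- Only words of length `7` have nonzero weight, so `p` and `q` together are a single letter.
  by_cases h : p.length + q.length = 1
  · have h : (∃ i, p = [i] ∧ q = []) ∨ ∃ i, p = [] ∧ q = [i] := by
      rcases Nat.add_eq_one_iff.1 h with ⟨h1, h2⟩ | ⟨h1, h2⟩
      · obtain ⟨i, rfl⟩ := List.length_eq_one_iff.1 h2
        exact Or.inr ⟨i, List.length_eq_zero_iff.1 h1, rfl⟩
      · obtain ⟨i, rfl⟩ := List.length_eq_one_iff.1 h1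
        exact Or.inl ⟨i, rfl, List.length_eq_zero_iff.1 h2⟩
    rcases h with ⟨i, rfl, rfl⟩ | ⟨i, rfl, rfl⟩ <;> fin_cases i <;> simp [topWeight] <;> ring
  · have h0 : ∀ l : List (Fin 2), l.length = 6 → topWeight F (p ++ l ++ q) = 0 := by
      intro l hl
      have hne : ∀ w : List (Fin 2), w.length = 7 → p ++ l ++ q ≠ w := by
        rintro w hw rfl
        simp only [List.length_append] at hw
        lia
      rw [topWeight, if_neg (hne _ rfl), if_neg (hne _ rfl)]
    rw [h0 _ rfl, h0 _ rfl, h0 _ rfl, h0 _ rfl]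
    simp

theorem topFunctional_h₂ (p q : List (Fin 2)) : topFunctional F p q (FreeA.h₂ F) = 0 := by
  simp only [FreeA.h₂, mon_mul, map_sub, map_smul, topFunctional_mon]
  change (2 : F) • topWeight F (p ++ lettersW₁ ++ q) -
    (5 : F) • topWeight F (p ++ lettersW₂ ++ q) = 0
  by_cases h : p.length + q.length = 0
  · rw [Nat.add_eq_zero_iff, List.length_eq_zero_iff, List.length_eq_zero_iff] at h
    rw [h.1, h.2]
    simp [topWeight]
    ring
  · have h0 : ∀ l : List (Fin 2), l.length = 7 → topWeight F (p ++ l ++ q) = 0 := by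
      intro l hl
      have hne : ∀ w : List (Fin 2), w.length = 7 → p ++ l ++ q ≠ w := by
        rintro w hw rfl
        simp only [List.length_append] at hw
        lia
      rw [topWeight, if_neg (hne _ rfl), if_neg (hne _ rfl)]
    rw [h0 _ rfl, h0 _ rfl]
    simp

theorem topFunctional_mon_eq_zero {m : Mon} (h₁ : ¬ m.Divides Mon.W₁) (h₂ : ¬ m.Divides Mon.W₂)
    (p q : List (Fin 2)) : topFunctional F p q (FreeA.mon F m) = 0 := by
  rw [topFunctional_mon]
  rw [divides_iff] at h₁ h₂
  exact topWeight_eq_zero h₁ h₂ p q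

theorem topFunctional_gens {a : FreeA F} (ha : a ∈ FreeA.gens F) (p q : List (Fin 2)) :
    topFunctional F p q a = 0 := by
  rcases ha with (((⟨m, hm, rfl⟩ | ⟨m, hm, rfl⟩) | ⟨m, ⟨hm, h₁, h₂⟩, rfl⟩) | ⟨m, ⟨-, h₁, h₂⟩, rfl⟩) |
    rfl | rfl
  · have hm : m.letters.length = 8 := hm
    refine topFunctional_mon_eq_zero (fun h => ?_) (fun h => ?_) p q <;>
    · have := ((divides_iff _ _).1 h).length_le
      simp [hm, letters_W₁, letters_W₂] at this
  · have hm : 2 < m.letters.count 0 := hm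
    refine topFunctional_mon_eq_zero (fun h => ?_) (fun h => ?_) p q <;>
    · have := ((divides_iff _ _).1 h).sublist.count_le 0
      simp [letters_W₁, letters_W₂] at this
      lia
  · have hm : m.letters.length = 7 := hm
    refine topFunctional_mon_eq_zero (fun h => h₁ ?_) (fun h => h₂ ?_) p q <;>
    · exact letters_injective (((divides_iff _ _).1 h).eq_of_length hm)
  · exact topFunctional_mon_eq_zero h₁ h₂ p q
  · exact topFunctional_h₁ p q
  · exact topFunctional_h₂ p q

/-- The functional `topFunctional [] []` vanishes on the ideal `I`. -/
theorem topFunctional_eq_zero_of_mem {a : FreeA F} (ha : a ∈ algIdealSpan F (FreeA.gens F)) :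
    topFunctional F [] [] a = 0 := by
  let J : Submodule F (FreeA F) := ⨅ p, ⨅ q, LinearMap.ker (topFunctional F p q)
  have hJ : ∀ b, b ∈ J ↔ ∀ p q, topFunctional F p q b = 0 := by
    intro b
    simp [J, Submodule.mem_iInf]
  have haJ : a ∈ J := by
    simp only [algIdealSpan, Submodule.mem_sInf] at ha
    refine ha J ⟨fun b hb => (hJ b).2 fun p q => topFunctional_gens hb p q, fun b u hu => ?_⟩
    rw [hJ] at hu
    induction b using MonoidAlgebra.induction_linear with
    | zero => simp
    | add b c hb hc =>
      rw [add_mul, mul_add]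
      exact ⟨add_mem hb.1 hc.1, add_mem hb.2 hc.2⟩
    | single m r =>
      rw [single_eq_smul_mon, smul_mul_assoc, mul_smul_comm]
      refine ⟨J.smul_mem _ ((hJ _).2 fun p q => ?_), J.smul_mem _ ((hJ _).2 fun p q => ?_)⟩
      · rw [topFunctional_mon_mul, hu]
      · rw [topFunctional_mul_mon, hu]
  exact (hJ a).1 haJ [] []

theorem wordB_lettersW₂_ne_zero [CharZero F] : wordB F lettersW₂ ≠ 0 := by
  intro h
  rw [← letters_W₂, ← projB_mon] at h
  have h : AlgQuotient.mk (F := F) (FreeA.gens F) (FreeA.mon F Mon.W₂) = 0 :=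
    toUnitization_injective F (R := AlgB F) (h.trans (map_zero (toUnitization F (R := AlgB F))).symm)
  rw [← map_zero (AlgQuotient.mk (F := F) (FreeA.gens F)), AlgQuotient.mk_eq_mk, sub_zero] at h
  have h := topFunctional_eq_zero_of_mem h
  rw [topFunctional_mon] at h
  simp [topWeight, letters_W₂] at h

end NonVanishing

/-! ### A group commutator of weight six -/

section Commutator

variable {F : Type*} [Field F]

-- The scalar action on the unitization of `B` agrees with that of its algebra structure only after
-- unfolding `AlgQuotient`, so instance search does not find these two.
instance : IsScalarTower F (Unitization F (AlgB F)) (Unitization F (AlgB F)) :=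
  ⟨fun r a b => Algebra.smul_mul_assoc r a b⟩

instance : SMulCommClass F (Unitization F (AlgB F)) (Unitization F (AlgB F)) :=
  ⟨fun r a b => (Algebra.mul_smul_comm r a b).symm⟩

variable (F) in
/-- The span of the words of degree `i` in `x` and of degree at least `j` in `y`. -/
noncomputable def bidegreeSpan (i j : ℕ) : Submodule F (Unitization F (AlgB F)) :=
  wordSpan F {l | l.count 0 = i ∧ j ≤ l.count 1}

theorem mul_mem_bidegreeSpan {i j i' j' : ℕ} {a b : Unitization F (AlgB F)}
    (ha : a ∈ bidegreeSpan F i j) (hb : b ∈ bidegreeSpan F i' j') {k n : ℕ} (hk : k = i + i')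
    (hn : n ≤ j + j') : a * b ∈ bidegreeSpan F k n := by
  refine wordSpan_mul_le ?_ (Submodule.mul_mem_mul ha hb)
  intro l hl l' hl'
  simp only [Set.mem_ofPred_eq, List.count_append] at hl hl' ⊢
  lia

theorem bidegreeSpan_anti {i j j' : ℕ} (h : j ≤ j') :
    bidegreeSpan F i j' ≤ bidegreeSpan F i j :=
  wordSpan_le fun _ hl => wordB_mem_wordSpan ⟨hl.1, h.trans hl.2⟩

theorem wordB_mem_bidegreeSpan (l : List (Fin 2)) :
    wordB F l ∈ bidegreeSpan F (l.count 0) (l.count 1) :=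
  wordB_mem_wordSpan ⟨rfl, le_rfl⟩

theorem bidegreeSpan_eq_bot {i j : ℕ}
    (h : ∀ l ∈ lettersW₁.tails.flatMap List.inits ++ lettersW₂.tails.flatMap List.inits,
      ¬ (l.count 0 = i ∧ j ≤ l.count 1)) : bidegreeSpan F i j = ⊥ :=
  wordSpan_eq_bot fun _ hl =>
    ⟨fun hi => h _ (List.mem_append_left _ (mem_flatMap_inits_of_infix hi)) hl,
      fun hi => h _ (List.mem_append_right _ (mem_flatMap_inits_of_infix hi)) hl⟩

theorem eq_zero_of_mem_bidegreeSpan_of_three_le {i j : ℕ} {a : Unitization F (AlgB F)}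
    (ha : a ∈ bidegreeSpan F i j) (hi : 3 ≤ i) : a = 0 := by
  have h : ∀ l ∈ lettersW₁.tails.flatMap List.inits ++ lettersW₂.tails.flatMap List.inits,
      l.count 0 ≤ 2 := by decide
  rw [bidegreeSpan_eq_bot fun l hl h' => by have := h l hl; lia] at ha
  simpa using ha

/-- In `y x y³ x y` and `y² x y x y²`, every factor with five letters `y` has both letters `x`. -/
theorem eq_zero_of_mem_bidegreeSpan_one_five {a : Unitization F (AlgB F)}
    (ha : a ∈ bidegreeSpan F 1 5) : a = 0 := by
  rw [bidegreeSpan_eq_bot (by decide)] at ha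
  simpa using ha

theorem eq_zero_of_mem_bidegreeSpan_two_six {a : Unitization F (AlgB F)}
    (ha : a ∈ bidegreeSpan F 2 6) : a = 0 := by
  rw [bidegreeSpan_eq_bot (by decide)] at ha
  simpa using ha

variable [CharZero F]

theorem nilExp_sub_one_sub_mem {c : F} :
    nilExp F (c • wordB F [1]) - 1 - c • wordB F [1] ∈ bidegreeSpan F 0 2 := by
  have h2 : wordB F [1] ^ 2 = wordB F [1, 1] := by simp [wordB, pow_succ]
  have h3 : wordB F [1] ^ 3 = wordB F [1, 1, 1] := by simp [wordB, pow_succ, mul_assoc]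
  have h4 : wordB F [1] ^ 4 = 0 := by
    rw [← wordB_eq_zero (F := F) (l := [1, 1, 1, 1]) (by decide) (by decide)]
    simp [wordB, pow_succ, mul_assoc]
  rw [nilExp_eq_sum (M := 4) (by rw [smul_pow, h4, smul_zero])]
  simp only [Finset.sum_range_succ, Finset.sum_range_zero, pow_zero, pow_one, smul_pow, h2, h3]
  have h5 : wordB F [1, 1] ∈ bidegreeSpan F 0 2 := wordB_mem_bidegreeSpan [1, 1]
  have h6 : wordB F [1, 1, 1] ∈ bidegreeSpan F 0 2 :=
    bidegreeSpan_anti (by simp : 2 ≤ 3) (wordB_mem_bidegreeSpan [1, 1, 1])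
  convert add_mem (Submodule.smul_mem _ ((Nat.factorial 2 : F)⁻¹ * c ^ 2) h5)
    (Submodule.smul_mem _ ((Nat.factorial 3 : F)⁻¹ * c ^ 3) h6) using 1
  simp only [mul_smul, Nat.factorial_zero, Nat.factorial_one, Nat.cast_one, inv_one, one_smul]
  abel

theorem nilExp_sub_one_mem_bidegreeSpan {c : F} :
    nilExp F (c • wordB F [1]) - 1 ∈ bidegreeSpan F 0 1 := by
  have h := add_mem (bidegreeSpan_anti (by simp : 1 ≤ 2) (nilExp_sub_one_sub_mem (F := F) (c := c)))
    (Submodule.smul_mem _ c (wordB_mem_bidegreeSpan (F := F) [1]))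
  rwa [sub_add_cancel] at h

/-- Conjugation by `exp y` is, up to higher terms, the identity plus bracketing with `y`. -/
theorem conj_sub_mem_bidegreeSpan {g g' : Unitization F (AlgB F)} (hg : g = nilExp F (wordB F [1]))
    (hg' : g' = nilExp F (-wordB F [1])) (hgg : g' * g = 1) {i j : ℕ} {a : Unitization F (AlgB F)}
    (ha : a ∈ bidegreeSpan F i j) :
    g' * a * g - a ∈ bidegreeSpan F i (j + 1) ∧
    g' * a * g - a - (a * wordB F [1] - wordB F [1] * a) ∈ bidegreeSpan F i (j + 2) := by
  have h1 := nilExp_sub_one_mem_bidegreeSpan (F := F) (c := 1)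
  have h2 := nilExp_sub_one_sub_mem (F := F) (c := 1)
  have h3 := nilExp_sub_one_mem_bidegreeSpan (F := F) (c := -1)
  rw [one_smul, ← hg] at h1 h2
  rw [neg_one_smul, ← hg'] at h3
  have h4 : a * (g - 1) - (g - 1) * a ∈ bidegreeSpan F i (j + 1) :=
    sub_mem (mul_mem_bidegreeSpan ha h1 (by lia) le_rfl)
      (mul_mem_bidegreeSpan h1 ha (by lia) (by lia))
  have h5 : (g' - 1) * (a * (g - 1) - (g - 1) * a) ∈ bidegreeSpan F i (j + 2) :=
    mul_mem_bidegreeSpan h3 h4 (by lia) (by lia)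
  have h6 : a * (g - 1 - wordB F [1]) - (g - 1 - wordB F [1]) * a ∈ bidegreeSpan F i (j + 2) :=
    sub_mem (mul_mem_bidegreeSpan ha h2 (by lia) le_rfl)
      (mul_mem_bidegreeSpan h2 ha (by lia) (by lia))
  have e : g' * a * g - a = a * (g - 1) - (g - 1) * a + (g' - 1) * (a * (g - 1) - (g - 1) * a) := by
    have : g' * a * g - a = g' * (a * g - g * a) := by
      rw [mul_sub, ← mul_assoc, ← mul_assoc, hgg, one_mul]
    rw [this]
    noncomm_ring
  constructor
  · rw [e]
    exact add_mem h4 (bidegreeSpan_anti (by lia) h5)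
  · convert add_mem h5 h6 using 1
    rw [e]
    noncomm_ring

/-- One commutation step. The terms of degree at least three in `x` vanish, so the commutator of
`1 + a + b` with `g` is `1 + a' + b'`, where `a' = aᵍ - a` and `b' = bᵍ - b - a a'`. -/
theorem commutator_eq {g g' c c' a b : Unitization F (AlgB F)} {j j' : ℕ}
    (hg : g = nilExp F (wordB F [1])) (hg' : g' = nilExp F (-wordB F [1])) (hgg : g' * g = 1)
    (hc : c = 1 + a + b) (hcc : c' * c = 1)
    (ha : a ∈ bidegreeSpan F 1 j) (hb : b ∈ bidegreeSpan F 2 j') :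
    c' * g' * c * g = 1 + (g' * a * g - a) + (g' * b * g - b - a * (g' * a * g - a)) := by
  have ha' := bidegreeSpan_anti (Nat.le_succ j) (conj_sub_mem_bidegreeSpan hg hg' hgg ha).1
  have hb' := bidegreeSpan_anti (Nat.le_succ j') (conj_sub_mem_bidegreeSpan hg hg' hgg hb).1
  set s := g' * a * g - a with hs
  set t := g' * b * g - b with ht
  have z : ∀ {i i' j j' : ℕ} {u v : Unitization F (AlgB F)}, u ∈ bidegreeSpan F i j →
      v ∈ bidegreeSpan F i' j' → 3 ≤ i + i' → u * v = 0 := fun hu hv h =>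
    eq_zero_of_mem_bidegreeSpan_of_three_le (mul_mem_bidegreeSpan hu hv rfl le_rfl) h
  have haa := mul_mem_bidegreeSpan ha ha rfl le_rfl
  have hc' : c' = 1 - a - b + a * a := by
    have h : c * (1 - a - b + a * a) = 1 := by
      have e : c * (1 - a - b + a * a) =
          1 + a * (a * a) - a * b - b * a - b * b + b * (a * a) := by
        rw [hc]; noncomm_ring
      rw [e, z ha haa (by lia), z ha hb (by lia), z hb ha (by lia), z hb hb (by lia),
        z hb haa (by lia)]
      abel
    calc c' = c' * (c * (1 - a - b + a * a)) := by rw [h, mul_one]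
      _ = 1 - a - b + a * a := by rw [← mul_assoc, hcc, one_mul]
  have hconj : g' * c * g = c + s + t := by
    have e : g' * c * g = g' * g + g' * a * g + g' * b * g := by rw [hc]; noncomm_ring
    rw [e, hgg, hs, ht, hc]
    abel
  have e : c' * g' * c * g = c' * (c + s + t) := by rw [← hconj]; simp only [mul_assoc]
  have e' : (1 - a - b + a * a) * (s + t) =
      s + t - a * s - (a * t + b * s + b * t - a * a * s - a * a * t) := by noncomm_ring
  rw [e, add_assoc, mul_add, hcc, hc', e', z ha hb' (by lia), z hb ha' (by lia), z hb hb' (by lia),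
    z haa ha' (by lia), z haa hb' (by lia)]
  abel

/-- The iterated bracket `[x y x, y, …, y]`, with `k` times `y`. -/
noncomputable def iterBracket (F : Type*) [Field F] : ℕ → Unitization F (AlgB F)
  | 0 => wordB F [0, 1, 0]
  | k + 1 => iterBracket F k * wordB F [1] - wordB F [1] * iterBracket F k

omit [CharZero F] in
theorem iterBracket_four : iterBracket F 4 = (6 : F) • wordB F lettersW₂ := by
  have h : ∀ l : List (Fin 2), ¬ l <:+: lettersW₁ → ¬ l <:+: lettersW₂ → wordB F l = 0 :=
    fun l => wordB_eq_zero
  simp only [iterBracket, sub_mul, mul_sub, ← wordB_append, List.cons_append, List.nil_append]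
  rw [h [0, 1, 0, 1, 1, 1, 1] (by decide) (by decide), h [1, 0, 1, 0, 1, 1, 1] (by decide) (by decide),
    h [1, 1, 1, 0, 1, 0, 1] (by decide) (by decide), h [1, 1, 1, 1, 0, 1, 0] (by decide) (by decide)]
  module

/-- With `x` and `y` in the group, the commutator `(x, y, …, y)`, with `k + 1` times `y`, is `1`, plus
a part of degree one in `x`, plus `[x y x, y, …, y]` and terms of higher degree in `y`. -/
theorem map_iterate_commutator {G : Type*} [Group G] (φ : G →* Unitization F (AlgB F)) {u v : G}
    (hu : φ u = nilExp F (wordB F [0])) (hv : φ v = nilExp F (wordB F [1])) (k : ℕ) :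
    ∃ a ∈ bidegreeSpan F 1 (k + 1), ∃ b ∈ bidegreeSpan F 2 (k + 1),
      φ ((fun w => w⁻¹ * v⁻¹ * w * v)^[k + 1] u) = 1 + a + b ∧
      b - iterBracket F k ∈ bidegreeSpan F 2 (k + 2) := by
  have hinv : ∀ w : G, φ w⁻¹ * φ w = 1 := fun w => by rw [← map_mul, inv_mul_cancel, map_one]
  have hy : IsNilpotent (wordB F [1]) := ⟨4, by
    rw [← wordB_eq_zero (F := F) (l := [1, 1, 1, 1]) (by decide) (by decide)]
    simp [wordB, pow_succ, mul_assoc]⟩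
  have hv' : φ v⁻¹ = nilExp F (-wordB F [1]) := by
    have h : φ v * φ v⁻¹ = 1 := by rw [← map_mul, mul_inv_cancel, map_one]
    rw [← one_mul (φ v⁻¹), ← nilExp_neg_mul_nilExp (F := F) hy, mul_assoc, ← hv, h, mul_one]
  have hstep : ∀ w : G, ∀ a b j j', φ w = 1 + a + b → a ∈ bidegreeSpan F 1 j →
      b ∈ bidegreeSpan F 2 j' → φ (w⁻¹ * v⁻¹ * w * v) = 1 + (φ v⁻¹ * a * φ v - a) +
        (φ v⁻¹ * b * φ v - b - a * (φ v⁻¹ * a * φ v - a)) := by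
    intro w a b j j' hw ha hb
    rw [map_mul, map_mul, map_mul]
    exact commutator_eq hv hv' (hinv v) hw (hinv w) ha hb
  have hconj : ∀ {i j a}, a ∈ bidegreeSpan F i j → _ := fun {i j a} ha =>
    conj_sub_mem_bidegreeSpan (i := i) (j := j) (a := a) hv hv' (hinv v) ha
  induction k with
  | zero =>
    have hxx : wordB F [0] * wordB F [0] = 0 := by
      rw [← wordB_append]
      exact wordB_eq_zero (by decide) (by decide)
    have hx : wordB F [0] ∈ bidegreeSpan F 1 0 := wordB_mem_bidegreeSpan [0]
    have hu' : φ u = 1 + wordB F [0] + 0 := by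
      rw [hu, nilExp_eq_sum (M := 2) (by rw [pow_two, hxx])]
      simp [Finset.sum_range_succ]
    obtain ⟨h1, h2⟩ := hconj hx
    have hstep0 := hstep u _ 0 0 0 hu' hx (zero_mem _)
    refine ⟨_, h1, _, ?_, hstep0, ?_⟩
    · rw [mul_zero, zero_mul, sub_zero, zero_sub]
      exact neg_mem (mul_mem_bidegreeSpan hx h1 rfl (by lia))
    · have h3 := neg_mem (mul_mem_bidegreeSpan hx h2 (k := 2) (n := 2) rfl (by lia))
      convert h3 using 1
      have h4 : wordB F [0] * (wordB F [0] * wordB F [1] - wordB F [1] * wordB F [0]) =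
          -wordB F [0, 1, 0] := by
        rw [mul_sub, ← mul_assoc, hxx, zero_mul, zero_sub, ← wordB_append, ← wordB_append]
        rfl
      rw [mul_sub _ _ (_ * _ - _ * _), h4, iterBracket, mul_zero, zero_mul]
      abel
  | succ k ih =>
    obtain ⟨a, ha, b, hb, hw, hbk⟩ := ih
    rw [Function.iterate_succ_apply']
    obtain ⟨h1, -⟩ := hconj ha
    obtain ⟨h3, h4⟩ := hconj hb
    refine ⟨_, h1, _, ?_, hstep _ a b _ _ hw ha hb, ?_⟩
    · exact sub_mem h3 (mul_mem_bidegreeSpan ha h1 rfl (by lia))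
    · have h5 : a * (φ v⁻¹ * a * φ v - a) ∈ bidegreeSpan F 2 (k + 3) :=
        mul_mem_bidegreeSpan ha h1 rfl (by lia)
      have hy := wordB_mem_bidegreeSpan (F := F) [1]
      have h6 : (b - iterBracket F k) * wordB F [1] - wordB F [1] * (b - iterBracket F k) ∈
          bidegreeSpan F 2 (k + 3) :=
        sub_mem (mul_mem_bidegreeSpan hbk hy rfl le_rfl)
          (mul_mem_bidegreeSpan hy hbk rfl (by simp; lia))
      convert add_mem (sub_mem h4 h5) h6 using 1
      rw [iterBracket]
      noncomm_ring

end Commutator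

/-- The Lie algebra `[B]` is nilpotent and `5`-Engel, and the group `[B]^*` (the set `[B]` with the
Baker–Campbell–Hausdorff product, which is a group) is not `5`-Engel. -/
theorem corollary1p4 (F : Type*) [Field F] [CharZero F] :
    LieRing.IsNilpotent (CommutatorLie (AlgB F)) ∧
    IsEngelLie (CommutatorLie (AlgB F)) 5 ∧
    ∃ _ : Group (CommutatorLie (AlgB F)),
      (∀ u v : CommutatorLie (AlgB F), u * v = bch F u v) ∧
      ¬ IsEngelGroup (CommutatorLie (AlgB F)) 5 := by
  obtain ⟨G, hmul, φ, hφ⟩ := exists_group_mul_eq_bch F (R := AlgB F) range_toUnitization_pow_eight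
  refine ⟨isNilpotent_commutatorLie_algB F, isEngelLie_algB F, G, hmul, fun hE => ?_⟩
  have hletter : ∀ i : Fin 2, ∃ u : CommutatorLie (AlgB F), toUnitization F u = wordB F [i] :=
    fun i => ⟨CommutatorLie.of (AlgQuotient.mk (FreeA.gens F) (FreeA.mon F (FreeSemigroup.of i))),
      projB_mon F (FreeSemigroup.of i)⟩
  obtain ⟨x, hx⟩ := hletter 0
  obtain ⟨y, hy⟩ := hletter 1
  obtain ⟨a, ha, b, -, hab, hb⟩ := map_iterate_commutator φ (by rw [hφ, hx]) (by rw [hφ, hy]) 4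
  have hb := eq_zero_of_mem_bidegreeSpan_two_six hb
  rw [iterBracket_four, sub_eq_zero] at hb
  rw [hE x y, map_one, eq_zero_of_mem_bidegreeSpan_one_five ha, hb, add_zero, left_eq_add] at hab
  exact wordB_lettersW₂_ne_zero ((smul_eq_zero.1 hab).resolve_left (by norm_num))
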